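/- **Theorem (Long-Term Stability).** *Setting.* Let $\tilde\Omega\subset\mathbb R^3$ be a bounded open set with Lipschitz boundary $\tilde\Gamma$ and outward unit normal $\tilde N$, and for $t\ge t_0$ let $\lambda^*(\cdot,t)$ be maps of $\tilde\Omega$ into space, one-to-one, $C^2$ in $(\tilde x,t)$ up to the boundary, with $\tilde F=\partial\lambda^*/\partial\tilde x$, $\tilde J=\det\tilde F>0$ up to the boundary, and reference velocity $\tilde v^{ref}=\partial\lambda^*/\partial t$. Let $\tilde\Gamma=\tilde\Gamma_{free}\cup\tilde\Gamma_{wall}$, where the walls are fixed and impermeable: $\tilde F^{-t}\tilde N\cdot\tilde v^{ref}=0$ and $\tilde F^{-t}\tilde N\cdot\tilde v=0$ on $\tilde\Gamma_{wall}$. Let $R_t\subset\overline{\tilde\Omega}$ (possibly empty) be sets on which the fluid is at rest at time $t$. For a vector field $\tilde w$ put $\tilde D(\tilde w)=\frac12\big(\tilde\nabla\tilde w\tilde F^{-1}+(\tilde\nabla\tilde w\tilde F^{-1})^t\big)$. Let $\rho,\mu>0$ be constant, $\nu=\mu/\rho$, and let $\tilde v$ ($C^1$ in $(\tilde x,t)$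 up to the boundary), $\tilde p$ (continuous in $\tilde x$ up to the boundary) and a body force $\tilde b(t)\in L^2(\tilde\Omega)$ satisfy, for all $t\ge t_0$: $\tilde\nabla\tilde v:\tilde F^{-t}=0$, $\tilde v=0$ on $R_t$, the wall condition, and, for every $\tilde w\in C^1(\overline{\tilde\Omega})^3$, $$\rho\int_{\tilde\Omega}\tilde w\cdot\frac{\partial\tilde v}{\partial t}\tilde J+\rho\int_{\tilde\Omega}\tilde w\cdot\tilde\nabla\tilde v\big[\tilde F^{-1}(\tilde v-\tilde v^{ref})\big]\tilde J=\rho\int_{\tilde\Omega}\tilde w\cdot\tilde b\,\tilde J+\int_{\tilde\Omega}\tilde p\,\tilde\nabla\tilde w:\tilde F^{-t}\tilde J-2\mu\int_{\tilde\Omega}\tilde D(\tilde w):\tilde D(\tilde v)\tilde J+\int_{\tilde\Gamma}\tilde w\cdot\tilde P\tilde N ,$$ where $\tilde P=(-\tilde p I+2\mu\tilde D(\tilde v))\tilde F^{-t}\tilde J$. Let $\tilde K(t)=\frac12\rho\|\tilde v\tilde J^{1/2}\|^2_{L^2(\tilde\Omega)}$. Let $C$ be a Poincaré–Korn constant of the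 moving domain: $C>0$, and for every $t\ge t_0$ and every kinematically admissible field $\tilde w$ (that is, $C^1$ up to the boundary, $\tilde\nabla\tilde w:\tilde F^{-t}=0$ in $\tilde\Omega$, $\tilde F^{-t}\tilde N\cdot\tilde w=0$ on $\tilde\Gamma_{wall}$, $\tilde w=0$ on $R_t$) $$\tfrac C2\|\tilde w\tilde J^{1/2}\|^2_{L^2(\tilde\Omega)}\le\|\tilde D(\tilde w)\tilde J^{1/2}\|^2_{L^2(\tilde\Omega)} .$$ (a) Suppose that the description is purely Lagrangian at free boundaries ($\tilde v^{ref}=\tilde v$ on $\tilde\Gamma_{free}$ for all $t\ge t_0$) and that, for all $t\ge t_0$, all norms being finite, $$\rho\|\tilde b\tilde J^{1/2}\|^2_{L^2(\tilde\Omega)}+\|\tilde P\tilde N\|^2_{L^2(\tilde\Gamma)}+\nu^2C^2\|\tilde v\|^2_{L^2(\tilde\Gamma)}\le M^2 .$$ Then for all $t\ge t_0$ $$\tilde K(t)\le e^{-\nu C(t-t_0)}\tilde K(t_0)+\big(1-e^{-\nu C(t-t_0)}\big)\frac{M^2}{2\nu^2C^2},$$ and hence $\limsup_{t\to\infty}\tilde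 K(t)\le\dfrac{M^2}{2\nu^2C^2}$. (b) For all $0<R_{min}<R_{max}$ there is a number $C>0$, depending on $R_{min}$ and $R_{max}$ only, that is a Poincaré–Korn constant of every moving domain of the above kind with the following property: for every $t\ge t_0$ there is a closed ball $B_t$ of radius $R_{min}$ such that $\lambda^*(\tilde\Omega,t)$ lies in the open ball of radius $R_{max}$ with the same centre, $\lambda^*(\tilde\Omega,t)\cup B_t$ is star-shaped about every point of $B_t$, and all points of $\overline{\tilde\Omega}$ that $\lambda^*(\cdot,t)$ maps into $B_t$ belong to $R_t$. -/

import Mathlib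

open MeasureTheory Set Filter Topology

noncomputable section

namespace ALE

/-- Three-dimensional Euclidean space. -/
abbrev E3 : Type := EuclideanSpace ℝ (Fin 3)

/-- The matrix inner product `A : B = A_ij B_ij`. -/
def ddot (A B : Matrix (Fin 3) (Fin 3) ℝ) : ℝ := ∑ i, ∑ j, A i j * B i j

/-- A matrix applied to a vector of Euclidean space. -/
def act (A : Matrix (Fin 3) (Fin 3) ℝ) (u : E3) : E3 := WithLp.toLp 2 (A.mulVec u.ofLp)

/-- The gradient `(∇f)_ij = ∂ f_i / ∂ x_j` of a vector field. -/
def grad (f : E3 → E3) (x : E3) : Matrix (Fin 3) (Fin 3) ℝ :=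
  Matrix.of fun i j => fderiv ℝ f x (EuclideanSpace.single j 1) i

/-- `N` is the outward unit normal to `Ω` at the boundary point `x`: near `x` the set `Ω` is,
to first order, the half-space `⟪y - x, N⟫ < 0`. -/
def IsOutwardNormal (Ω : Set E3) (x N : E3) : Prop :=
  ‖N‖ = 1 ∧ ∀ ε > 0, ∀ᶠ y in 𝓝 x,
    (inner ℝ (y - x) N < -ε * ‖y - x‖ → y ∈ Ω) ∧ (ε * ‖y - x‖ < inner ℝ (y - x) N → y ∉ Ω)

open Classical in
/-- The outward unit normal field of `Ω` (zero where there is no normal). -/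
def outwardNormal (Ω : Set E3) (x : E3) : E3 :=
  if h : ∃ N, IsOutwardNormal Ω x N then h.choose else 0

/-- The boundary of `Ω` is Lipschitz: near each boundary point `Ω` is the region below the graph
of a Lipschitz function, for some choice `e` of the vertical direction. The function `φ` of the
two horizontal coordinates is written as a function on space that does not vary along `e`. -/
def HasLipschitzBoundary (Ω : Set E3) : Prop :=
  ∀ x ∈ frontier Ω, ∃ (e : E3) (φ : E3 → ℝ) (L : NNReal) (r : ℝ), ‖e‖ = 1 ∧ 0 < r ∧
    LipschitzWith L φ ∧ (∀ (y : E3) (s : ℝ), φ (y + s • e) = φ y) ∧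
    ∀ y ∈ Metric.ball x r, y ∈ Ω ↔ inner ℝ y e < φ y

/-- Surface measure on the boundary of `Ω`. -/
def surf (Ω : Set E3) : Measure E3 := (μHE[2] : Measure E3).restrict (frontier Ω)

/-- A moving reference: the referential domain `Ω`, the initial time `t₀` and the map `lam`, which
takes the referential point `x` at time `t ≥ t₀` to its spatial position `lam t x`. The boundary
of `Ω` is made up of the free boundary `free` and the part `wall` that corresponds to fixed,
impermeable boundaries. At time `t` the velocity is known to vanish on the set `rest t`
(for instance at no-slip walls or in a neighbourhood at rest); this set may be empty.
Being `C²` up to the boundary is expressed by a `C²` extension across it. -/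
structure Reference where
  Ω : Set E3
  t₀ : ℝ
  lam : ℝ → E3 → E3
  free : Set E3
  wall : Set E3
  rest : ℝ → Set E3
  isOpen : IsOpen Ω
  bounded : Bornology.IsBounded Ω
  lipschitz : HasLipschitzBoundary Ω
  smooth : ∀ t, t₀ ≤ t → ∀ x ∈ closure Ω, ContDiffAt ℝ 2 (fun q : ℝ × E3 => lam q.1 q.2) (t, x)
  injOn : ∀ t, t₀ ≤ t → InjOn (lam t) Ω
  det_pos : ∀ t, t₀ ≤ t → ∀ x ∈ closure Ω, 0 < (grad (lam t) x).det
  boundary : free ∪ wall = frontier Ω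
  rest_subset : ∀ t, t₀ ≤ t → rest t ⊆ closure Ω
  /-- A wall does not move in space: its normal velocity, as seen by the reference, is zero. -/
  wall_fixed : ∀ t, t₀ ≤ t → ∀ x ∈ wall, ∀ N, IsOutwardNormal Ω x N →
    inner ℝ (act ((grad (lam t) x)⁻¹).transpose N) (deriv (fun s => lam s x) t) = 0

namespace Reference

variable (S : Reference)

/-- The deformation gradient of the reference. -/
def F (t : ℝ) (x : E3) : Matrix (Fin 3) (Fin 3) ℝ := grad (S.lam t) x

/-- The Jacobian of the reference. -/
def J (t : ℝ) (x : E3) : ℝ := (S.F t x).det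

/-- The velocity of the reference. -/
def vref (t : ℝ) (x : E3) : E3 := deriv (fun s => S.lam s x) t

/-- The spatial velocity gradient `∇w F⁻¹` in terms of the reference. -/
def sgrad (t : ℝ) (w : E3 → E3) (x : E3) : Matrix (Fin 3) (Fin 3) ℝ := grad w x * (S.F t x)⁻¹

/-- The rate of deformation `D(w) = (∇w F⁻¹ + (∇w F⁻¹)ᵗ) / 2`. -/
def D (t : ℝ) (w : E3 → E3) (x : E3) : Matrix (Fin 3) (Fin 3) ℝ :=
  (1 / 2 : ℝ) • (S.sgrad t w x + (S.sgrad t w x).transpose)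

/-- The incompressibility condition `∇w : F⁻ᵗ = 0`. -/
def Incompressible (t : ℝ) (w : E3 → E3) : Prop :=
  ∀ x ∈ S.Ω, ddot (grad w x) ((S.F t x)⁻¹).transpose = 0

/-- No flow through the walls: `F⁻ᵗ N · w = 0`. -/
def Impermeable (t : ℝ) (w : E3 → E3) : Prop :=
  ∀ x ∈ S.wall, ∀ N, IsOutwardNormal S.Ω x N →
    inner ℝ (act ((S.F t x)⁻¹).transpose N) (w x) = 0

/-- Kinematically admissible velocity fields at time `t`: `C¹` up to the boundary,
incompressible, not crossing the walls and vanishing on the set that is at rest. -/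
structure Admissible (t : ℝ) (w : E3 → E3) : Prop where
  smooth : ∀ x ∈ closure S.Ω, ContDiffAt ℝ 1 w x
  incompressible : S.Incompressible t w
  impermeable : S.Impermeable t w
  at_rest : ∀ x ∈ S.rest t, w x = 0

/-- `C` is a Poincaré–Korn constant of the moving domain: at every time, every kinematically
admissible field `w` satisfies `(C / 2) ‖w J^{1/2}‖² ≤ ‖D(w) J^{1/2}‖²`. -/
def IsPoincareKornConstant (C : ℝ) : Prop :=
  0 < C ∧ ∀ t, S.t₀ ≤ t → ∀ w : E3 → E3, S.Admissible t w →
    C / 2 * ∫ x in S.Ω, ‖w x‖ ^ 2 * S.J t x ≤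
      ∫ x in S.Ω, ddot (S.D t w x) (S.D t w x) * S.J t x

/-- The first Piola–Kirchhoff stress `P = (-p I + 2 μ D(v)) F⁻ᵗ J` of a Newtonian fluid. -/
def P (μ : ℝ) (v : ℝ → E3 → E3) (p : ℝ → E3 → ℝ) (t : ℝ) (x : E3) :
    Matrix (Fin 3) (Fin 3) ℝ :=
  S.J t x • ((-(p t x) • (1 : Matrix (Fin 3) (Fin 3) ℝ) + (2 * μ) • S.D t (v t) x) *
    ((S.F t x)⁻¹).transpose)

/-- The boundary traction `P N`. -/
def traction (μ : ℝ) (v : ℝ → E3 → E3) (p : ℝ → E3 → ℝ) (t : ℝ) (x : E3) : E3 :=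
  act (S.P μ v p t x) (outwardNormal S.Ω x)

/-- The variational momentum equation at time `t`, tested with `w`. -/
def Momentum (ρ μ : ℝ) (v : ℝ → E3 → E3) (p : ℝ → E3 → ℝ) (b : ℝ → E3 → E3) (t : ℝ)
    (w : E3 → E3) : Prop :=
  ρ * (∫ x in S.Ω, inner ℝ (w x) (deriv (fun s => v s x) t) * S.J t x) +
    ρ * (∫ x in S.Ω,
      inner ℝ (w x) (act (S.sgrad t (v t) x) (v t x - S.vref t x)) * S.J t x) =
  ρ * (∫ x in S.Ω, inner ℝ (w x) (b t x) * S.J t x) +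
    (∫ x in S.Ω, p t x * ddot (grad w x) ((S.F t x)⁻¹).transpose * S.J t x) -
    2 * μ * (∫ x in S.Ω, ddot (S.D t w x) (S.D t (v t) x) * S.J t x) +
    ∫ x, inner ℝ (w x) (S.traction μ v p t x) ∂(surf S.Ω)

/-- The velocity `v`, the pressure `p` and the body force `b` describe the motion of an
incompressible Newtonian fluid of density `ρ` and viscosity `μ` in terms of the reference. -/
structure IsFlow (ρ μ : ℝ) (v : ℝ → E3 → E3) (p : ℝ → E3 → ℝ) (b : ℝ → E3 → E3) : Prop where
  smooth : ∀ t, S.t₀ ≤ t → ∀ x ∈ closure S.Ω,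
    ContDiffAt ℝ 1 (fun q : ℝ × E3 => v q.1 q.2) (t, x)
  pressure : ∀ t, S.t₀ ≤ t → ContinuousOn (p t) (closure S.Ω)
  force : ∀ t, S.t₀ ≤ t → MemLp (b t) 2 (volume.restrict S.Ω)
  incompressible : ∀ t, S.t₀ ≤ t → S.Incompressible t (v t)
  impermeable : ∀ t, S.t₀ ≤ t → S.Impermeable t (v t)
  at_rest : ∀ t, S.t₀ ≤ t → ∀ x ∈ S.rest t, v t x = 0
  momentum : ∀ t, S.t₀ ≤ t → ∀ w : E3 → E3, (∀ x ∈ closure S.Ω, ContDiffAt ℝ 1 w x) →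
    S.Momentum ρ μ v p b t w

/-- The description is purely Lagrangian at free boundaries: the reference moves there with the
velocity of the fluid. -/
def LagrangianAtFree (v : ℝ → E3 → E3) : Prop :=
  ∀ t, S.t₀ ≤ t → ∀ x ∈ S.free, S.vref t x = v t x

/-- The total kinetic energy `K = (ρ / 2) ‖v J^{1/2}‖²`. -/
def K (ρ : ℝ) (v : ℝ → E3 → E3) (t : ℝ) : ℝ :=
  1 / 2 * ρ * ∫ x in S.Ω, ‖v t x‖ ^ 2 * S.J t x

/-- The load and free-surface bound
`ρ ‖b J^{1/2}‖² + ‖P N‖²_Γ + ν² C² ‖v‖²_Γ ≤ M²`, all norms being finite. -/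
def LoadBound (ρ μ C M : ℝ) (v : ℝ → E3 → E3) (p : ℝ → E3 → ℝ) (b : ℝ → E3 → E3) : Prop :=
  ∀ t, S.t₀ ≤ t →
    MemLp (S.traction μ v p t) 2 (surf S.Ω) ∧ MemLp (v t) 2 (surf S.Ω) ∧
    ρ * (∫ x in S.Ω, ‖b t x‖ ^ 2 * S.J t x) + (∫ x, ‖S.traction μ v p t x‖ ^ 2 ∂(surf S.Ω)) +
      (μ / ρ) ^ 2 * C ^ 2 * (∫ x, ‖v t x‖ ^ 2 ∂(surf S.Ω)) ≤ M ^ 2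

/-- At every time the region filled by the fluid lies within distance `Rmax` of a centre `o t`,
and together with the closed ball of radius `Rmin` about that centre it is star-shaped about each
point of this ball; all of the fluid in this ball is at rest. The ball may be a neighbourhood
inside the fluid or a rigid body that the fluid surrounds. -/
def StarShapedAboutRest (Rmin Rmax : ℝ) (o : ℝ → E3) : Prop :=
  ∀ t, S.t₀ ≤ t →
    S.lam t '' S.Ω ⊆ Metric.ball (o t) Rmax ∧
    (∀ y ∈ Metric.closedBall (o t) Rmin,
      StarConvex ℝ y (S.lam t '' S.Ω ∪ Metric.closedBall (o t) Rmin)) ∧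
    ∀ x ∈ closure S.Ω, S.lam t x ∈ Metric.closedBall (o t) Rmin → x ∈ S.rest t

end Reference

end ALE

end

/-! Decay. Testing the momentum equation with `v` itself removes the pressure, by incompressibility.
The convective power equals the integral of `|v|² / 2` times the rate of change of `J`: by Piola's
identity and Euler's expansion formula, the difference of the integrands is the divergence of `|v|²
/ 2 · J F⁻¹ (v - vref)`. This flux has no normal component: the relative velocity vanishes at free
boundaries, and both normal velocities vanish at walls (`integral_convective`). What remains is `K'
= power of the loads - dissipation` (`IsFlow.hasDerivAt_K`). With `κ = ν C`, the Poincaré–Korn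
inequality bounds the dissipation below by `2 κ K`. Young's inequality with weight `κ` spends half
of this on the body force, so `K' ≤ -κ K + M² / (2 κ)`, and Gronwall's inequality concludes.

The divergence theorem is needed only for tangential fields, which avoids surface integrals
altogether: under a Lipschitz graph, the indicator of the domain is approximated by Lipschitz
cutoffs, and tangency compensates their steep slope (`setIntegral_divergence_eq_zero_of_graph`).

Korn constant. In spatial coordinates let `u` vanish on a ball about which the region is
star-shaped. Along a segment from `y` in the ball to `x`, the derivative of `⟪x - y, u⟫` is a
quadratic form of the gradient, so only its symmetric part enters. Integration over the segment and
then over `x` bounds `⟪x - y, u x⟫` in L² (`lintegral_inner_sq_le`). The centre and three further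
points `y` of the ball, displaced along the axes, recover all components of `u`
(`lintegral_norm_sq_le_symGrad`). A change of variables carries the inequality back to the
reference. -/

namespace ALE

/-! ### Divergence and integration by parts against Lipschitz functions. -/

/-- The divergence of a vector field. -/
noncomputable def divergence (V : E3 → E3) (x : E3) : ℝ := (grad V x).trace

lemma divergence_eq_sum (V : E3 → E3) (x : E3) :
    divergence V x = ∑ j, fderiv ℝ V x (EuclideanSpace.single j 1) j := rfl

/-- The coordinate functionals on space. -/
noncomputable def coordL (j : Fin 3) : E3 →L[ℝ] ℝ := EuclideanSpace.proj j

lemma sum_coord_smul_single (u : E3) :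
    ∑ j, u j • (EuclideanSpace.single j (1 : ℝ) : E3) = u := by
  ext i
  simp [Finset.sum_apply, Pi.single_apply]

lemma fderiv_coord {E : Type*} [NormedAddCommGroup E] [NormedSpace ℝ E] {V : E → E3} {x : E}
    (h : DifferentiableAt ℝ V x) (j : Fin 3) (u : E) :
    fderiv ℝ (fun y => V y j) x u = fderiv ℝ V x u j := by
  have := ((coordL j).hasFDerivAt.comp x h.hasFDerivAt).fderiv
  have e : (fun y => V y j) = (coordL j) ∘ V := rfl
  rw [e, this]; rfl

lemma contDiff_coord {V : E3 → E3} {n : ℕ∞} (hV : ContDiff ℝ n V) (j : Fin 3) :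
    ContDiff ℝ n (fun y => V y j) :=
  (coordL j).contDiff.comp hV

/-- Integration by parts against a Lipschitz function. -/
lemma integral_mul_divergence {f : E3 → ℝ} {L : NNReal} (hf : LipschitzWith L f) {V : E3 → E3}
    (hV : ContDiff ℝ 1 V) (hc : HasCompactSupport V) :
    ∫ x, f x * divergence V x = -∫ x, fderiv ℝ f x (V x) := by
  have hd : Differentiable ℝ V := hV.differentiable (by norm_num)
  have hVj : ∀ j, ContDiff ℝ 1 (fun y => V y j) := fun j => contDiff_coord (n := 1) hV j
  have hcj : ∀ j, HasCompactSupport (fun y => V y j) := fun j =>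
    hc.comp_left (g := fun u : E3 => u j) rfl
  have hdj : ∀ j x, lineDeriv ℝ (fun y => V y j) x (-EuclideanSpace.single j 1) =
      -(fderiv ℝ V x (EuclideanSpace.single j 1) j) := fun j x => by
    rw [((hVj j).differentiable (by norm_num)).differentiableAt.lineDeriv_eq_fderiv, map_neg,
      fderiv_coord (hd x)]
  have key : ∀ j, ∫ x, lineDeriv ℝ f x (EuclideanSpace.single j 1) * V x j =
      -∫ x, f x * fderiv ℝ V x (EuclideanSpace.single j 1) j := fun j => by
    obtain ⟨D, hD⟩ := (hVj j).lipschitzWith_of_hasCompactSupport (hcj j) (by norm_num)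
    rw [hf.integral_lineDeriv_mul_eq hD (hcj j), ← integral_neg]
    congr 1; ext x; rw [hdj]; ring
  have int1 : ∀ j ∈ Finset.univ, Integrable fun x : E3 =>
      f x * fderiv ℝ V x (EuclideanSpace.single j 1) j := fun j _ => by
    refine Continuous.integrable_of_hasCompactSupport ?_ ?_
    · refine hf.continuous.mul ?_
      have h1 := (hV.continuous_fderiv (by norm_num)).clm_apply
        (continuous_const (y := (EuclideanSpace.single j (1 : ℝ) : E3)))
      exact (coordL j).continuous.comp h1
    · refine HasCompactSupport.mul_left (f := f) ?_
      exact (hc.fderiv ℝ).comp_left (g := fun A : E3 →L[ℝ] E3 => A (EuclideanSpace.single j 1) j) rfl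
  have int2 : ∀ j ∈ Finset.univ, Integrable fun x : E3 =>
      lineDeriv ℝ f x (EuclideanSpace.single j 1) * V x j := fun j _ => by
    exact ((hVj j).continuous.integrable_of_hasCompactSupport (hcj j)).bdd_mul
      (hf.memLp_lineDeriv _).aestronglyMeasurable
      (ae_of_all _ fun x => norm_lineDeriv_le_of_lipschitz ℝ hf)
  calc ∫ x, f x * divergence V x
      = ∑ j, ∫ x, f x * fderiv ℝ V x (EuclideanSpace.single j 1) j := by
        rw [← integral_finsetSum _ int1]; simp_rw [divergence_eq_sum, Finset.mul_sum]
    _ = -∑ j, ∫ x, lineDeriv ℝ f x (EuclideanSpace.single j 1) * V x j := by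
        simp_rw [key, Finset.sum_neg_distrib, neg_neg]
    _ = -∫ x, fderiv ℝ f x (V x) := by
        rw [← integral_finsetSum _ int2]
        congr 1
        -- By Rademacher's theorem the line derivatives come from a Fréchet derivative almost
        -- everywhere.
        refine integral_congr_ae ?_
        filter_upwards [hf.ae_differentiableAt (μ := volume)] with x hx
        conv_rhs => rw [← sum_coord_smul_single (V x)]
        simp only [map_sum, map_smul, smul_eq_mul]
        refine Finset.sum_congr rfl fun j _ => ?_
        rw [hx.lineDeriv_eq_fderiv, mul_comm]

lemma integral_divergence_eq_zero_of_hasCompactSupport {V : E3 → E3}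
    (hV : ContDiff ℝ 1 V) (hc : HasCompactSupport V) : ∫ x, divergence V x = 0 := by
  simpa using integral_mul_divergence (LipschitzWith.const (1 : ℝ)) hV hc

lemma divergence_eq_zero_of_notMem_tsupport {V : E3 → E3} {x : E3} (hx : x ∉ tsupport V) :
    divergence V x = 0 := by
  have : fderiv ℝ V x = 0 := by
    by_contra h
    exact hx (tsupport_fderiv_subset ℝ (subset_tsupport _ h))
  simp [divergence_eq_sum, this]

lemma continuous_divergence {V : E3 → E3} (hV : ContDiff ℝ 1 V) : Continuous (divergence V) := by
  have : divergence V = fun x => ∑ j, fderiv ℝ V x (EuclideanSpace.single j 1) j := rfl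
  rw [this]
  refine continuous_finsetSum _ fun j _ => ?_
  exact (coordL j).continuous.comp
    ((hV.continuous_fderiv (by norm_num)).clm_apply continuous_const)

/-! ### The divergence theorem for tangential fields under a Lipschitz graph. -/

/-- Below the graph of a Lipschitz function `φ`, the outward normal at a point where `φ` is
differentiable. -/
lemma isOutwardNormal_of_graph {Ω : Set E3} {e z : E3} {φ : E3 → ℝ} {x : E3} {r : ℝ}
    (he : ‖e‖ = 1) (hinv : ∀ (y : E3) (s : ℝ), φ (y + s • e) = φ y)
    (hΩ : ∀ y ∈ Metric.ball x r, y ∈ Ω ↔ inner ℝ y e < φ y) (hz : z ∈ Metric.ball x r)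
    (hze : inner ℝ z e = φ z) {n : E3} (hφ : HasFDerivAt φ (innerSL ℝ (e - n)) z) :
    ∃ c : ℝ, 0 < c ∧ IsOutwardNormal Ω z (c • n) := by
  -- Here `n = e - ∇φ`. Since `φ` is constant along `e`, `∇φ` is orthogonal to `e`; in particular `n
  -- ≠ 0`.
  have hne : inner ℝ n e = (1 : ℝ) := by
    have h1 : HasDerivAt (fun s : ℝ => φ (z + s • e)) (inner ℝ (e - n) e) 0 := by
      have h2 : HasDerivAt (fun s : ℝ => z + s • e) e 0 := by
        simpa using ((hasDerivAt_id (0 : ℝ)).smul_const e).const_add z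
      have h3 : HasFDerivAt φ (innerSL ℝ (e - n)) (z + (0 : ℝ) • e) := by simpa using hφ
      exact h3.comp_hasDerivAt (0 : ℝ) h2
    have h4 : HasDerivAt (fun s : ℝ => φ (z + s • e)) 0 0 := by
      simp_rw [hinv]; exact hasDerivAt_const _ _
    have h5 := h1.unique h4
    rw [inner_sub_left, real_inner_self_eq_norm_sq, he] at h5
    linarith
  have hn : 0 < ‖n‖ := by
    rw [norm_pos_iff]; rintro rfl; simp at hne
  refine ⟨‖n‖⁻¹, inv_pos.2 hn, ?_, fun ε hε => ?_⟩
  · rw [norm_smul, norm_inv, norm_norm, inv_mul_cancel₀ hn.ne']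
  · have hlo := hφ.isLittleO.def (c := ε * ‖n‖) (by positivity)
    filter_upwards [hlo, Metric.isOpen_ball.mem_nhds hz] with y hy hyb
    simp only [innerSL_apply_apply, Real.norm_eq_abs] at hy
    have e1 : inner ℝ (y - z) (‖n‖⁻¹ • n) = ‖n‖⁻¹ * inner ℝ (y - z) n := inner_smul_right _ _ _
    have e2 : φ y - φ z - inner ℝ (e - n) (y - z) = φ y - inner ℝ y e + inner ℝ (y - z) n := by
      rw [inner_sub_left, ← hze, real_inner_comm (y - z) n, real_inner_comm (y - z) e,
        inner_sub_left y z e]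
      ring
    rw [e2, abs_le] at hy
    have e3 : inner ℝ (y - z) n = ‖n‖ * (‖n‖⁻¹ * inner ℝ (y - z) n) := by
      field_simp
    rw [hΩ y hyb, e1]
    constructor
    · intro h
      have := mul_lt_mul_of_pos_left h hn
      rw [← e3] at this
      nlinarith [hy.1]
    · intro h
      have := mul_lt_mul_of_pos_left h hn
      rw [← e3] at this
      nlinarith [hy.2]

/-- The function `y ↦ φ y - ⟪y, e⟫`, clamped after scaling by `c`: a Lipschitz approximation of the
indicator function of the region below the graph of `φ`. -/
noncomputable def graphCutoff (φ : E3 → ℝ) (e : E3) (c : ℝ) (y : E3) : ℝ :=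
  min 1 (max 0 (c * (φ y - inner ℝ y e)))

section Graph

variable {φ : E3 → ℝ} {e : E3} {L : NNReal}

lemma graphCutoff_nonneg (c : ℝ) (y : E3) : 0 ≤ graphCutoff φ e c y :=
  le_min zero_le_one (le_max_left _ _)

lemma graphCutoff_le_one (c : ℝ) (y : E3) : graphCutoff φ e c y ≤ 1 := min_le_left _ _

lemma graphCutoff_eq_zero {c : ℝ} (hc : 0 ≤ c) {y : E3} (h : φ y - inner ℝ y e ≤ 0) :
    graphCutoff φ e c y = 0 := by
  rw [graphCutoff, max_eq_left (mul_nonpos_of_nonneg_of_nonpos hc h), min_eq_right zero_le_one]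

lemma graphCutoff_eq_one {c : ℝ} {y : E3} (h : 1 ≤ c * (φ y - inner ℝ y e)) :
    graphCutoff φ e c y = 1 :=
  min_eq_left (h.trans (le_max_right _ _))

lemma exists_lipschitzWith_graphCutoff (hφ : LipschitzWith L φ) (c : ℝ) :
    ∃ K, LipschitzWith K (graphCutoff φ e c) := by
  have h1 : LipschitzWith ‖(innerSL ℝ e : E3 →L[ℝ] ℝ)‖₊ fun y : E3 => inner ℝ y e := by
    simpa [real_inner_comm] using (innerSL ℝ e : E3 →L[ℝ] ℝ).lipschitz
  have h2 := (lipschitzWith_smul c).comp (hφ.sub h1)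
  exact ⟨_, (h2.const_max 0).const_min 1⟩

/-- Such points are global extrema of the clamped function. This covers the corners of the clamp
too, where differentiability may fail and `fderiv` is zero by default. -/
lemma fderiv_graphCutoff_eq_zero {c : ℝ} (hc : 0 ≤ c) {y : E3}
    (h : φ y - inner ℝ y e ≤ 0 ∨ 1 ≤ c * (φ y - inner ℝ y e)) :
    fderiv ℝ (graphCutoff φ e c) y = 0 := by
  rcases h with h | h
  · refine IsLocalMin.fderiv_eq_zero (Eventually.of_forall fun x => ?_)
    rw [graphCutoff_eq_zero hc h]; exact graphCutoff_nonneg c x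
  · refine IsLocalMax.fderiv_eq_zero (Eventually.of_forall fun x => ?_)
    rw [graphCutoff_eq_one h]; exact graphCutoff_le_one c x

lemma fderiv_graphCutoff {c : ℝ} (hc : 0 < c) (hφ : Continuous φ) {y : E3}
    (hd : DifferentiableAt ℝ φ y)
    (h0 : 0 < φ y - inner ℝ y e) (h1 : c * (φ y - inner ℝ y e) < 1) (u : E3) :
    fderiv ℝ (graphCutoff φ e c) y u = c * (fderiv ℝ φ y u - inner ℝ u e) := by
  have hcont : Continuous fun y : E3 => φ y - inner ℝ y e := by fun_prop
  have hev : graphCutoff φ e c =ᶠ[𝓝 y] fun y => c * (φ y - inner ℝ y e) := by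
    filter_upwards [hcont.continuousAt.eventually (lt_mem_nhds h0),
      (hcont.const_smul c).continuousAt.eventually (gt_mem_nhds h1)] with x hx hx'
    have hx1 : c * (φ x - inner ℝ x e) < 1 := hx'
    rw [graphCutoff, max_eq_right (by positivity), min_eq_right hx1.le]
  have hi : HasFDerivAt (fun y : E3 => (inner ℝ y e : ℝ)) (innerSL ℝ e : E3 →L[ℝ] ℝ) y := by
    simpa [real_inner_comm] using (innerSL ℝ e : E3 →L[ℝ] ℝ).hasFDerivAt (x := y)
  have hF : HasFDerivAt (fun y => c * (φ y - inner ℝ y e))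
      (c • (fderiv ℝ φ y - (innerSL ℝ e : E3 →L[ℝ] ℝ))) y := (hd.hasFDerivAt.sub hi).const_mul c
  rw [hev.fderiv_eq, hF.fderiv]
  simp [real_inner_comm]

lemma mem_frontier_of_graph {Ω : Set E3} (ho : IsOpen Ω) (he : ‖e‖ = 1) {x z : E3} {r : ℝ}
    (hinv : ∀ (y : E3) (s : ℝ), φ (y + s • e) = φ y)
    (hΩ : ∀ y ∈ Metric.ball x r, y ∈ Ω ↔ inner ℝ y e < φ y) (hz : z ∈ Metric.ball x r)
    (hze : inner ℝ z e = φ z) : z ∈ frontier Ω := by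
  rw [ho.frontier_eq]
  refine ⟨?_, fun h => ((hΩ z hz).1 h).ne hze⟩
  have ht : Tendsto (fun s : ℝ => z + (-s) • e) (𝓝[>] 0) (𝓝 z) := by
    have : Continuous fun s : ℝ => z + (-s) • e := by fun_prop
    simpa using (this.tendsto 0).mono_left nhdsWithin_le_nhds
  refine mem_closure_of_tendsto ht ?_
  filter_upwards [ht.eventually (Metric.isOpen_ball.mem_nhds hz), self_mem_nhdsWithin] with s hs hs0
  rw [hΩ _ hs, hinv, inner_add_left, hze, inner_smul_left, real_inner_self_eq_norm_sq, he]
  simp only [mem_Ioi] at hs0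
  simp [hs0]

/-- A field tangent to the graph of `φ` is nearly tangent to the levels just below the graph. -/
lemma abs_fderiv_sub_inner_le {Ω : Set E3} (ho : IsOpen Ω) (he : ‖e‖ = 1)
    (hφ : LipschitzWith L φ) {x : E3} {r : ℝ}
    (hinv : ∀ (y : E3) (s : ℝ), φ (y + s • e) = φ y)
    (hΩ : ∀ y ∈ Metric.ball x r, y ∈ Ω ↔ inner ℝ y e < φ y)
    {V : E3 → E3} {D : NNReal} (hD : LipschitzWith D V) (hs : tsupport V ⊆ Metric.ball x r)
    (hN : ∀ z ∈ frontier Ω, ∀ N, IsOutwardNormal Ω z N → inner ℝ (V z) N = 0) {y : E3}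
    (hd : DifferentiableAt ℝ φ y) (h0 : 0 < φ y - inner ℝ y e) :
    |fderiv ℝ φ y (V y) - inner ℝ (V y) e| ≤ (L + 1) * (D * (φ y - inner ℝ y e)) := by
  set d := φ y - inner ℝ y e with hdd
  -- `z` is the point of the graph straight above `y`. By invariance along `e`, `φ` has the same
  -- derivative at `z` as at `y`. There the estimated quantity is zero, by tangency or because `z`
  -- is outside the support of `V`. Only the variation of `V` over the distance `d` is left.
  set z := y + d • e with hz
  have hφz : φ z = φ y := hinv y d
  have hze : inner ℝ z e = φ z := by
    rw [hφz, hz, inner_add_left, inner_smul_left, real_inner_self_eq_norm_sq, he, hdd]; simp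
  have hfz : HasFDerivAt φ (fderiv ℝ φ y) z := by
    have h1 : HasFDerivAt (fun w => φ (w - d • e)) (fderiv ℝ φ y) z := by
      have h2 : HasFDerivAt φ (fderiv ℝ φ y) (z - d • e) := by
        rw [hz, add_sub_cancel_right]; exact hd.hasFDerivAt
      have h3 := h2.comp z ((hasFDerivAt_id z).sub_const (d • e))
      rw [ContinuousLinearMap.comp_id] at h3
      exact h3
    refine h1.congr_of_eventuallyEq (Eventually.of_forall fun w => ?_)
    have := hinv (w - d • e) d
    simpa using this
  have hVz : fderiv ℝ φ y (V z) - inner ℝ (V z) e = 0 := by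
    by_cases hzb : z ∈ Metric.ball x r
    · set n : E3 := e - (InnerProductSpace.toDual ℝ E3).symm (fderiv ℝ φ y) with hn
      have hin : ∀ u, inner ℝ (e - n) u = fderiv ℝ φ y u := fun u => by
        rw [hn, sub_sub_cancel, InnerProductSpace.toDual_symm_apply]
      have heq : (innerSL ℝ (e - n) : E3 →L[ℝ] ℝ) = fderiv ℝ φ y := by
        ext u; exact hin u
      obtain ⟨c, hc, hcN⟩ := isOutwardNormal_of_graph he hinv hΩ hzb hze (n := n) (heq ▸ hfz)
      have := hN z (mem_frontier_of_graph ho he hinv hΩ hzb hze) _ hcN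
      rw [inner_smul_right, mul_eq_zero, or_iff_right hc.ne'] at this
      rw [← hin, inner_sub_left, real_inner_comm, real_inner_comm _ n, this]; ring
    · have : V z = 0 := image_eq_zero_of_notMem_tsupport fun h => hzb (hs h)
      simp [this]
  have hsub : fderiv ℝ φ y (V y) - inner ℝ (V y) e =
      fderiv ℝ φ y (V y - V z) - inner ℝ (V y - V z) e := by
    rw [map_sub, inner_sub_left]; linarith
  have hVV : ‖V y - V z‖ ≤ D * d := by
    have := hD.dist_le_mul y z
    rwa [dist_eq_norm, dist_eq_norm, hz, sub_add_cancel_left, norm_neg, norm_smul, he, mul_one,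
      Real.norm_of_nonneg h0.le] at this
  rw [hsub]
  calc _ ≤ |fderiv ℝ φ y (V y - V z)| + |inner ℝ (V y - V z) e| := abs_sub _ _
    _ ≤ L * ‖V y - V z‖ + ‖V y - V z‖ * 1 := by
        refine add_le_add ?_ (he ▸ abs_real_inner_le_norm _ _)
        exact (ContinuousLinearMap.le_opNorm _ _).trans
          (mul_le_mul_of_nonneg_right (norm_fderiv_le_of_lipschitz ℝ hφ) (norm_nonneg _))
    _ = (L + 1) * ‖V y - V z‖ := by ring
    _ ≤ _ := by gcongr

/-- The divergence theorem near a boundary point, for a field tangent to the boundary. -/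
lemma setIntegral_divergence_eq_zero_of_graph {Ω : Set E3} (ho : IsOpen Ω) (he : ‖e‖ = 1)
    (hφ : LipschitzWith L φ) {x : E3} {r : ℝ}
    (hinv : ∀ (y : E3) (s : ℝ), φ (y + s • e) = φ y)
    (hΩ : ∀ y ∈ Metric.ball x r, y ∈ Ω ↔ inner ℝ y e < φ y)
    {V : E3 → E3} (hV : ContDiff ℝ 1 V) (hc : HasCompactSupport V)
    (hs : tsupport V ⊆ Metric.ball x r)
    (hN : ∀ z ∈ frontier Ω, ∀ N, IsOutwardNormal Ω z N → inner ℝ (V z) N = 0) :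
    ∫ y in Ω, divergence V y = 0 := by
  obtain ⟨D, hD⟩ := hV.lipschitzWith_of_hasCompactSupport hc (by norm_num)
  set χ : ℕ → E3 → ℝ := fun n => graphCutoff φ e (n + 1) with hχ
  have hlip : ∀ n, ∃ K, LipschitzWith K (χ n) := fun n => exists_lipschitzWith_graphCutoff hφ _
  have hχc : ∀ n, Continuous (χ n) := fun n => (hlip n).choose_spec.continuous
  have hdivc := continuous_divergence hV
  have hdivs : HasCompactSupport (divergence V) := by
    refine hc.mono' fun y hy => ?_
    by_contra h
    exact hy (divergence_eq_zero_of_notMem_tsupport h)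
  have hdivi : Integrable (divergence V) := hdivc.integrable_of_hasCompactSupport hdivs
  have hbig : ∀ y : E3, 0 < φ y - inner ℝ y e →
      ∀ᶠ n : ℕ in atTop, 1 ≤ ((n : ℝ) + 1) * (φ y - inner ℝ y e) := fun y hy => by
    have : Tendsto (fun n : ℕ => ((n : ℝ) + 1) * (φ y - inner ℝ y e)) atTop atTop :=
      (tendsto_natCast_atTop_atTop.atTop_add tendsto_const_nhds).atTop_mul_const hy
    exact this.eventually_ge_atTop 1
  have lim1 : Tendsto (fun n => ∫ y, χ n y * divergence V y) atTop
      (𝓝 (∫ y in Ω, divergence V y)) := by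
    rw [← integral_indicator ho.measurableSet]
    refine tendsto_integral_of_dominated_convergence (fun y => ‖divergence V y‖)
      (fun n => ((hχc n).mul hdivc).aestronglyMeasurable) hdivi.norm
      (fun n => ae_of_all _ fun y => ?_) (ae_of_all _ fun y => ?_)
    · rw [norm_mul, Real.norm_of_nonneg (graphCutoff_nonneg _ _)]
      exact mul_le_of_le_one_left (norm_nonneg _) (graphCutoff_le_one _ _)
    · by_cases hy : y ∈ Metric.ball x r
      · by_cases hyΩ : y ∈ Ω
        · have h0 : 0 < φ y - inner ℝ y e := sub_pos.2 ((hΩ y hy).1 hyΩ)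
          refine tendsto_const_nhds.congr' ?_
          filter_upwards [hbig y h0] with n hn
          rw [indicator_of_mem hyΩ, hχ]
          simp only [graphCutoff_eq_one hn, one_mul]
        · have h0 : φ y - inner ℝ y e ≤ 0 := sub_nonpos.2 (not_lt.1 fun h => hyΩ ((hΩ y hy).2 h))
          refine tendsto_const_nhds.congr fun n => ?_
          rw [indicator_of_notMem hyΩ, hχ]
          simp only [graphCutoff_eq_zero (by positivity : (0 : ℝ) ≤ n + 1) h0, zero_mul]
      · have h0 := divergence_eq_zero_of_notMem_tsupport fun h => hy (hs h)
        refine tendsto_const_nhds.congr fun n => ?_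
        have h1 : Ω.indicator (divergence V) y = 0 := indicator_apply_eq_zero.2 fun _ => h0
        rw [h0, mul_zero, h1]
  -- The slope `n + 1` acts only in a layer of height `1 / (n + 1)` below the graph, where the
  -- near-tangency of `V` gains a factor of that height. Hence the integrands are bounded uniformly
  -- in `n`, while each point eventually leaves the layer.
  have lim2 : Tendsto (fun n => ∫ y, fderiv ℝ (χ n) y (V y)) atTop (𝓝 (∫ _ : E3, (0 : ℝ))) := by
    have hKi : Integrable ((tsupport V).indicator fun _ : E3 => ((L : ℝ) + 1) * D) :=
      (integrable_indicator_iff hc.measurableSet).2 (integrableOn_const hc.measure_lt_top.ne)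
    refine tendsto_integral_of_dominated_convergence _
      (fun n => ?_) hKi (fun n => ?_) (ae_of_all _ fun y => ?_)
    · have h1 : Measurable fun y => fderiv ℝ (χ n) y := measurable_fderiv ℝ _
      have h2 : Measurable fun q : (E3 →L[ℝ] ℝ) × E3 => q.1 q.2 :=
        (isBoundedBilinearMap_apply.continuous).measurable
      exact (h2.comp (h1.prodMk hV.continuous.measurable)).aestronglyMeasurable
    · filter_upwards [hφ.ae_differentiableAt (μ := volume)] with y hy
      by_cases hyV : y ∈ tsupport V
      · rw [indicator_of_mem hyV]
        by_cases hcase : φ y - inner ℝ y e ≤ 0 ∨ 1 ≤ ((n : ℝ) + 1) * (φ y - inner ℝ y e)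
        · rw [hχ]
          simp only [fderiv_graphCutoff_eq_zero (by positivity : (0 : ℝ) ≤ n + 1) hcase]
          simp only [_root_.zero_apply, norm_zero]
          positivity
        · push Not at hcase
          rw [hχ]
          simp only
          rw [fderiv_graphCutoff (by positivity) hφ.continuous hy hcase.1 hcase.2, norm_mul,
            Real.norm_of_nonneg (by positivity : (0 : ℝ) ≤ n + 1), Real.norm_eq_abs]
          calc _ ≤ ((n : ℝ) + 1) * ((L + 1) * (D * (φ y - inner ℝ y e))) := by
                gcongr
                exact abs_fderiv_sub_inner_le ho he hφ hinv hΩ hD hs hN hy hcase.1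
            _ = ((L + 1) * D) * (((n : ℝ) + 1) * (φ y - inner ℝ y e)) := by ring
            _ ≤ ((L + 1) * D) * 1 := by gcongr; exact hcase.2.le
            _ = _ := mul_one _
      · rw [indicator_of_notMem hyV, image_eq_zero_of_notMem_tsupport hyV, map_zero, norm_zero]
    · refine tendsto_const_nhds.congr' ?_
      have : ∀ᶠ n : ℕ in atTop,
          φ y - inner ℝ y e ≤ 0 ∨ 1 ≤ ((n : ℝ) + 1) * (φ y - inner ℝ y e) := by
        by_cases h : φ y - inner ℝ y e ≤ 0
        · exact Eventually.of_forall fun _ => Or.inl h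
        · exact (hbig y (not_le.1 h)).mono fun _ => Or.inr
      filter_upwards [this] with n hn
      rw [hχ]
      simp only [fderiv_graphCutoff_eq_zero (by positivity : (0 : ℝ) ≤ n + 1) hn]
      rfl
  have heq : ∀ n, ∫ y, χ n y * divergence V y = -∫ y, fderiv ℝ (χ n) y (V y) := fun n =>
    integral_mul_divergence (hlip n).choose_spec hV hc
  simp_rw [heq] at lim1
  have := tendsto_nhds_unique lim1 lim2.neg
  simpa using this

end Graph

/-! ### From local to global: the divergence theorem on Lipschitz domains. -/

/-- Near each point of the closure, a tangential field localized by a smooth function has zero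
total divergence. -/
lemma exists_ball_setIntegral_divergence_eq_zero {Ω : Set E3} (ho : IsOpen Ω)
    (hL : HasLipschitzBoundary Ω) {G : E3 → E3} {x : E3} (hx : x ∈ closure Ω)
    (hG : ContDiffAt ℝ 1 G x)
    (hN : ∀ z ∈ frontier Ω, ∀ N, IsOutwardNormal Ω z N → inner ℝ (G z) N = 0) :
    ∃ r > 0, ∀ ψ : E3 → ℝ, ContDiff ℝ 1 ψ → HasCompactSupport ψ → tsupport ψ ⊆ Metric.ball x r →
      ContDiff ℝ 1 (fun y => ψ y • G y) ∧ ∫ y in Ω, divergence (fun y => ψ y • G y) y = 0 := by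
  obtain ⟨r₁, hr₁, hb₁⟩ := Metric.eventually_nhds_iff_ball.1 (hG.eventually (by norm_num))
  have hsm : ∀ ψ : E3 → ℝ, ContDiff ℝ 1 ψ → tsupport ψ ⊆ Metric.ball x r₁ →
      ContDiff ℝ 1 (fun y => ψ y • G y) := fun ψ hψ hs => by
    rw [contDiff_iff_contDiffAt]
    intro y
    by_cases hy : y ∈ Metric.ball x r₁
    · exact hψ.contDiffAt.smul (hb₁ y hy)
    · have h0 : ψ =ᶠ[𝓝 y] 0 := notMem_tsupport_iff_eventuallyEq.1 fun h => hy (hs h)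
      refine (contDiffAt_const (c := (0 : E3))).congr_of_eventuallyEq (h0.mono fun w hw => ?_)
      simp [hw]
  have hts : ∀ ψ : E3 → ℝ, tsupport (fun y => ψ y • G y) ⊆ tsupport ψ := fun ψ =>
    tsupport_smul_subset_left ψ G
  have hcs : ∀ ψ : E3 → ℝ, HasCompactSupport ψ → HasCompactSupport (fun y => ψ y • G y) :=
    fun ψ hψ => hψ.smul_right
  by_cases hxΩ : x ∈ Ω
  · obtain ⟨r₂, hr₂, hb₂⟩ := Metric.isOpen_iff.1 ho x hxΩ
    refine ⟨min r₁ r₂, lt_min hr₁ hr₂, fun ψ hψ hc hs => ?_⟩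
    have hV := hsm ψ hψ (hs.trans (Metric.ball_subset_ball (min_le_left _ _)))
    refine ⟨hV, ?_⟩
    rw [setIntegral_eq_integral_of_forall_compl_eq_zero,
      integral_divergence_eq_zero_of_hasCompactSupport hV (hcs ψ hc)]
    intro y hy
    exact divergence_eq_zero_of_notMem_tsupport fun h =>
      hy (hb₂ (Metric.ball_subset_ball (min_le_right _ _) (hs (hts ψ h))))
  · have hxf : x ∈ frontier Ω := by rw [ho.frontier_eq]; exact ⟨hx, hxΩ⟩
    obtain ⟨e, φ, L, r₂, he, hr₂, hφ, hinv, hg⟩ := hL x hxf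
    refine ⟨min r₁ r₂, lt_min hr₁ hr₂, fun ψ hψ hc hs => ?_⟩
    have hV := hsm ψ hψ (hs.trans (Metric.ball_subset_ball (min_le_left _ _)))
    refine ⟨hV, ?_⟩
    refine setIntegral_divergence_eq_zero_of_graph ho he hφ hinv hg hV (hcs ψ hc)
      (((hts ψ).trans hs).trans (Metric.ball_subset_ball (min_le_right _ _))) fun z hz N hzN => ?_
    rw [inner_smul_left, hN z hz N hzN, mul_zero]

lemma continuousOn_divergence {s : Set E3} {G : E3 → E3} (hG : ∀ x ∈ s, ContDiffAt ℝ 1 G x) :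
    ContinuousOn (divergence G) s := fun x hx => by
  have h := (hG x hx).continuousAt_fderiv (by norm_num)
  have : divergence G = fun x => ∑ j, coordL j (fderiv ℝ G x (EuclideanSpace.single j 1)) := rfl
  rw [this]
  refine ContinuousAt.continuousWithinAt (tendsto_finsetSum _ fun j _ => ?_)
  exact (coordL j).continuous.continuousAt.comp (h.clm_apply continuousAt_const)

/-- The divergence theorem on a bounded Lipschitz domain for a field that is tangent to the
boundary wherever there is a normal. -/
theorem setIntegral_divergence_eq_zero {Ω : Set E3} (ho : IsOpen Ω)
    (hb : Bornology.IsBounded Ω) (hL : HasLipschitzBoundary Ω) {G : E3 → E3}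
    (hG : ∀ x ∈ closure Ω, ContDiffAt ℝ 1 G x)
    (hN : ∀ z ∈ frontier Ω, ∀ N, IsOutwardNormal Ω z N → inner ℝ (G z) N = 0) :
    ∫ y in Ω, divergence G y = 0 := by
  have hK : IsCompact (closure Ω) := hb.isCompact_closure
  choose! r hr hloc using fun x (hx : x ∈ closure Ω) =>
    exists_ball_setIntegral_divergence_eq_zero ho hL hx (hG x hx) hN
  obtain ⟨t, htK, htc⟩ := hK.elim_nhds_subcover (fun x => Metric.ball x (r x / 3)) fun x hx =>
    Metric.ball_mem_nhds x (by have := hr x hx; positivity)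
  -- Each bump is 1 on the ball used in the cover and supported where the local result applies. The
  -- second branch only makes `b` total; centres in `t` have `r x > 0`.
  let b : ∀ x : E3, ContDiffBump x := fun x =>
    if h : 0 < r x then ⟨r x / 3, r x / 2, by positivity, by linarith⟩
    else ⟨1, 2, one_pos, one_lt_two⟩
  have hbin : ∀ x ∈ t, (b x).rIn = r x / 3 ∧ (b x).rOut = r x / 2 := fun x hx => by
    have : 0 < r x := hr x (htK x hx)
    simp only [b, dif_pos this, and_self]
  -- A telescoping substitute for a partition of unity: each new factor `1 - b a` removes a field
  -- supported near `a`, whose total divergence is zero. Once all factors are present, the field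
  -- vanishes near every point of the closure.
  have step : ∀ s : Finset E3, s ⊆ t → ContDiff ℝ 1 (fun y => ∏ x ∈ s, (1 - b x y)) ∧
      ∫ y in Ω, divergence (fun y => (∏ x ∈ s, (1 - b x y)) • G y) y =
        ∫ y in Ω, divergence G y := by
    intro s
    induction s using Finset.induction_on with
    | empty => intro _; simp [contDiff_const]
    | insert a s ha ih =>
      intro hs
      obtain ⟨hsm, hint⟩ := ih ((Finset.subset_insert a s).trans hs)
      have hat : a ∈ t := hs (Finset.mem_insert_self a s)
      have hba : ContDiff ℝ 1 (b a) := (b a).contDiff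
      set P : E3 → ℝ := fun y => ∏ x ∈ s, (1 - b x y) with hP
      have hprod : (fun y => ∏ x ∈ insert a s, (1 - b x y)) = fun y => (1 - b a y) * P y := by
        ext y; rw [Finset.prod_insert ha]
      refine ⟨by rw [hprod]; exact (contDiff_const.sub hba).mul hsm, ?_⟩
      have hψc : HasCompactSupport fun y => b a y * P y := (b a).hasCompactSupport.mul_right
      have hψs : tsupport (fun y => b a y * P y) ⊆ Metric.ball a (r a) := by
        refine (tsupport_mul_subset_left (f := b a) (g := P)).trans ?_
        rw [(b a).tsupport_eq, (hbin a hat).2]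
        exact Metric.closedBall_subset_ball (by have := hr a (htK a hat); linarith)
      obtain ⟨hV, hz⟩ := hloc a (htK a hat) _ (hba.mul hsm) hψc hψs
      have hPG : ∀ y ∈ closure Ω, ContDiffAt ℝ 1 (fun y => P y • G y) y := fun y hy =>
        hsm.contDiffAt.smul (hG y hy)
      have hi1 : IntegrableOn (divergence fun y => P y • G y) Ω :=
        ((continuousOn_divergence hPG).integrableOn_compact hK).mono_set subset_closure
      have hi2 : IntegrableOn (divergence fun y => (b a y * P y) • G y) Ω :=
        ((continuousOn_divergence fun y _ => hV.contDiffAt).integrableOn_compact hK).mono_set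
          subset_closure
      have hsplit : ∀ y ∈ Ω, divergence (fun y => (∏ x ∈ insert a s, (1 - b x y)) • G y) y =
          divergence (fun y => P y • G y) y - divergence (fun y => (b a y * P y) • G y) y := by
        intro y hy
        have e1 : (fun y => (∏ x ∈ insert a s, (1 - b x y)) • G y) =
            (fun y => P y • G y) - fun y => (b a y * P y) • G y := by
          ext1 y
          rw [Finset.prod_insert ha, Pi.sub_apply, ← sub_smul]
          congr 1; simp only [hP]; ring
        rw [e1]
        simp only [divergence_eq_sum]
        rw [fderiv_sub ((hPG y (subset_closure hy)).differentiableAt (by norm_num))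
          (hV.differentiable (by norm_num) y), ← Finset.sum_sub_distrib]
        rfl
      rw [setIntegral_congr_fun ho.measurableSet hsplit, integral_sub hi1 hi2, hz, sub_zero, hint]
  rw [← (step t subset_rfl).2]
  refine setIntegral_eq_zero_of_forall_eq_zero fun y hy => ?_
  have hyK : y ∈ closure Ω := subset_closure hy
  obtain ⟨a, hat, hya⟩ := mem_iUnion₂.1 (htc hyK)
  have h0 : (fun y => (∏ x ∈ t, (1 - b x y)) • G y) =ᶠ[𝓝 y] fun _ => 0 := by
    filter_upwards [Metric.isOpen_ball.mem_nhds hya] with w hw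
    rw [Finset.prod_eq_zero hat, zero_smul]
    rw [(b a).one_of_mem_closedBall, sub_self]
    rw [(hbin a hat).1]
    exact Metric.ball_subset_closedBall hw
  rw [divergence_eq_sum, h0.fderiv_eq]
  simp

/-! ### Matrix calculus: adjugate, determinant and Piola's identity. -/

section MatrixFunctions

variable {E : Type*} [NormedAddCommGroup E] [NormedSpace ℝ E]
  {A : E → Matrix (Fin 3) (Fin 3) ℝ} {x : E} {n : ℕ∞}

lemma contDiffAt_det (h : ∀ i j, ContDiffAt ℝ n (fun y => A y i j) x) :
    ContDiffAt ℝ n (fun y => (A y).det) x := by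
  simp only [Matrix.det_fin_three]; fun_prop

lemma contDiffAt_adjugate (h : ∀ i j, ContDiffAt ℝ n (fun y => A y i j) x) (i j : Fin 3) :
    ContDiffAt ℝ n (fun y => (A y).adjugate i j) x := by
  simp only [Matrix.adjugate_fin_three]
  fin_cases i <;> fin_cases j <;> simp <;> fun_prop

/-- The derivative of the adjugate matrix, by polarization of a quadratic map. -/
lemma fderiv_adjugate (h : ∀ i j, DifferentiableAt ℝ (fun y => A y i j) x) (u : E) (i j : Fin 3) :
    fderiv ℝ (fun y => (A y).adjugate i j) x u =
      ((A x + Matrix.of fun k l => fderiv ℝ (fun y => A y k l) x u).adjugate - (A x).adjugate -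
        (Matrix.of fun k l => fderiv ℝ (fun y => A y k l) x u).adjugate) i j := by
  have hm : ∀ a b c d, fderiv ℝ (fun y => A y a b * A y c d) x u =
      A x a b * fderiv ℝ (fun y => A y c d) x u + fderiv ℝ (fun y => A y a b) x u * A x c d :=
    fun a b c d => by
      rw [fderiv_fun_mul (h a b) (h c d)]
      simp [mul_comm]
  have hm' : ∀ a b c d, DifferentiableAt ℝ (fun y => A y a b * A y c d) x :=
    fun a b c d => (h a b).mul (h c d)
  have h1 : ∀ a b c d a' b' c' d',
      fderiv ℝ (fun y => A y a b * A y c d - A y a' b' * A y c' d') x u =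
      fderiv ℝ (fun y => A y a b * A y c d) x u - fderiv ℝ (fun y => A y a' b' * A y c' d') x u :=
    fun a b c d a' b' c' d' => by
      rw [fderiv_fun_sub (hm' _ _ _ _) (hm' _ _ _ _)]; rfl
  have h2 : ∀ a b c d a' b' c' d',
      fderiv ℝ (fun y => -(A y a b * A y c d) + A y a' b' * A y c' d') x u =
      -fderiv ℝ (fun y => A y a b * A y c d) x u + fderiv ℝ (fun y => A y a' b' * A y c' d') x u :=
    fun a b c d a' b' c' d' => by
      rw [fderiv_fun_add (hm' _ _ _ _).fun_neg (hm' _ _ _ _), fderiv_fun_neg]; rfl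
  simp only [Matrix.adjugate_fin_three]
  fin_cases i <;> fin_cases j <;> simp [h1, h2, hm] <;> ring

/-- Jacobi's formula for a curve of matrices. -/
lemma hasDerivAt_det {A : ℝ → Matrix (Fin 3) (Fin 3) ℝ} {A' : Matrix (Fin 3) (Fin 3) ℝ} {t : ℝ}
    (h : ∀ i j, HasDerivAt (fun s => A s i j) (A' i j) t) :
    HasDerivAt (fun s => (A s).det) (∑ j, ∑ i, (A t).adjugate j i * A' i j) t := by
  simp only [Matrix.det_fin_three]
  have h3 : ∀ a b c d e f, HasDerivAt (fun s => A s a b * A s c d * A s e f)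
      ((A' a b * A t c d + A t a b * A' c d) * A t e f + A t a b * A t c d * A' e f) t :=
    fun a b c d e f => ((h a b).mul (h c d)).mul (h e f)
  refine ((((((h3 0 0 1 1 2 2).sub (h3 0 0 1 2 2 1)).sub (h3 0 1 1 0 2 2)).add
    (h3 0 1 1 2 2 0)).add (h3 0 2 1 0 2 1)).sub (h3 0 2 1 1 2 0)).congr_deriv ?_
  simp [Matrix.adjugate_fin_three, Fin.sum_univ_three]
  ring

end MatrixFunctions

lemma act_apply (A : Matrix (Fin 3) (Fin 3) ℝ) (u : E3) (i : Fin 3) :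
    act A u i = ∑ j, A i j * u j := rfl

lemma grad_apply (f : E3 → E3) (x : E3) (i j : Fin 3) :
    grad f x i j = fderiv ℝ f x (EuclideanSpace.single j 1) i := rfl

lemma act_grad (f : E3 → E3) (x u : E3) : act (grad f x) u = fderiv ℝ f x u := by
  ext i
  rw [act_apply]
  conv_rhs => rw [← sum_coord_smul_single u]
  simp [grad_apply, mul_comm]

lemma inner_eq_sum (u w : E3) : inner ℝ u w = ∑ i, u i * w i := by
  simp [PiLp.inner_apply, mul_comm]

/-- Piola's identity: the columns of the adjugate of a gradient are divergence free. -/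
lemma sum_fderiv_adjugate_grad {f : E3 → E3} {x : E3} (hf : ContDiffAt ℝ 2 f x) (i : Fin 3) :
    ∑ j, fderiv ℝ (fun y => (grad f y).adjugate j i) x (EuclideanSpace.single j 1) = 0 := by
  have hA : DifferentiableAt ℝ (fderiv ℝ f) x :=
    (hf.fderiv_right (m := 1) (by norm_num)).differentiableAt (by norm_num)
  have hsym : IsSymmSndFDerivAt ℝ f x := hf.isSymmSndFDerivAt (by simp)
  have hd : ∀ k l, HasFDerivAt (fun y => grad f y k l)
      (((coordL k).comp (ContinuousLinearMap.apply ℝ E3 (EuclideanSpace.single l (1 : ℝ)))).comp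
        (fderiv ℝ (fderiv ℝ f) x)) x := fun k l =>
    ((coordL k).comp (ContinuousLinearMap.apply ℝ E3
      (EuclideanSpace.single l (1 : ℝ)))).hasFDerivAt.comp x hA.hasFDerivAt
  set c : Fin 3 → Fin 3 → Fin 3 → ℝ := fun k j l =>
    fderiv ℝ (fderiv ℝ f) x (EuclideanSpace.single j 1) (EuclideanSpace.single l 1) k with hc
  have hcs : ∀ k j l, c k j l = c k l j := fun k j l => by
    simp only [hc]; rw [hsym]
  have hfd : ∀ k j l, fderiv ℝ (fun y => grad f y k l) x (EuclideanSpace.single j 1) = c k j l :=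
    fun k j l => by rw [(hd k l).fderiv]; rfl
  simp only [fderiv_adjugate (fun k l => (hd k l).differentiableAt), hfd]
  simp only [Matrix.adjugate_fin_three, Fin.sum_univ_three]
  -- Ordering the indices of the mixed second derivatives makes the terms cancel in pairs.
  fin_cases i <;>
    simp [hcs _ 1 0, hcs _ 2 0, hcs _ 2 1] <;> ring

/-- The divergence of `g A u`, when the columns of `A` are divergence free. -/
lemma divergence_smul_act {g : E3 → ℝ} {A : E3 → Matrix (Fin 3) (Fin 3) ℝ} {u : E3 → E3} {x : E3}
    (hg : DifferentiableAt ℝ g x) (hA : ∀ i j, DifferentiableAt ℝ (fun y => A y i j) x)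
    (hu : DifferentiableAt ℝ u x)
    (hdiv : ∀ i, ∑ j, fderiv ℝ (fun y => A y j i) x (EuclideanSpace.single j 1) = 0) :
    divergence (fun y => g y • act (A y) (u y)) x =
      fderiv ℝ g x (act (A x) (u x)) + g x * ∑ j, ∑ i, A x j i * grad u x i j := by
  have huj : ∀ i, DifferentiableAt ℝ (fun y => u y i) x := fun i =>
    (coordL i).differentiableAt.comp x hu
  have hterm : ∀ i j, HasFDerivAt (fun y => A y j i * u y i)
      (A x j i • fderiv ℝ (fun y => u y i) x + u x i • fderiv ℝ (fun y => A y j i) x) x :=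
    fun i j => (hA j i).hasFDerivAt.mul (huj i).hasFDerivAt
  have hcomp : ∀ j, HasFDerivAt (fun y => (g y • act (A y) (u y)) j)
      (g x • ∑ i, (A x j i • fderiv ℝ (fun y => u y i) x + u x i • fderiv ℝ (fun y => A y j i) x) +
        (∑ i, A x j i * u x i) • fderiv ℝ g x) x := fun j => by
    have h := hg.hasFDerivAt.mul (HasFDerivAt.fun_sum (u := Finset.univ) fun i _ => hterm i j)
    exact h
  have hV : DifferentiableAt ℝ (fun y => g y • act (A y) (u y)) x := by
    rw [differentiableAt_euclidean]; exact fun j => (hcomp j).differentiableAt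
  have h0 := hdiv 0
  have h1 := hdiv 1
  have h2 := hdiv 2
  have hgexp : fderiv ℝ g x (act (A x) (u x)) =
      ∑ j, (∑ i, A x j i * u x i) * fderiv ℝ g x (EuclideanSpace.single j 1) := by
    conv_lhs => rw [← sum_coord_smul_single (act (A x) (u x))]
    simp [act_apply]
  have hVj : ∀ j, fderiv ℝ (fun y => g y • act (A y) (u y)) x (EuclideanSpace.single j 1) j =
      g x * ∑ i, (A x j i * grad u x i j +
        u x i * fderiv ℝ (fun y => A y j i) x (EuclideanSpace.single j 1)) +
        (∑ i, A x j i * u x i) * fderiv ℝ g x (EuclideanSpace.single j 1) := fun j => by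
    rw [← fderiv_coord hV j, (hcomp j).fderiv]
    simp only [_root_.add_apply, _root_.smul_apply, smul_eq_mul,
      _root_.sum_apply, grad_apply, fderiv_coord hu]
  rw [divergence_eq_sum, hgexp]
  simp only [hVj]
  simp only [Fin.sum_univ_three] at h0 h1 h2 ⊢
  linear_combination (g x * u x 0) * h0 + (g x * u x 1) * h1 + (g x * u x 2) * h2

/-! ### Time slices and mixed derivatives of space-time maps. -/

section SpaceTime

variable {f : ℝ → E3 → E3} {t : ℝ} {x : E3}

lemma hasFDerivAt_slice (h : DifferentiableAt ℝ (fun q : ℝ × E3 => f q.1 q.2) (t, x)) :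
    HasFDerivAt (f t) ((fderiv ℝ (fun q : ℝ × E3 => f q.1 q.2) (t, x)).comp
      (ContinuousLinearMap.inr ℝ ℝ E3)) x := by
  have h1 : HasFDerivAt (fun y : E3 => (t, y)) (ContinuousLinearMap.inr ℝ ℝ E3) x :=
    hasFDerivAt_prodMk_right t x
  exact h.hasFDerivAt.comp x h1

lemma hasDerivAt_slice (h : DifferentiableAt ℝ (fun q : ℝ × E3 => f q.1 q.2) (t, x)) :
    HasDerivAt (fun s => f s x) (fderiv ℝ (fun q : ℝ × E3 => f q.1 q.2) (t, x) (1, 0)) t := by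
  have h1 : HasDerivAt (fun s : ℝ => (s, x)) ((1 : ℝ), (0 : E3)) t :=
    (hasDerivAt_id t).prodMk (hasDerivAt_const t x)
  exact h.hasFDerivAt.comp_hasDerivAt t h1

lemma contDiffAt_slice {F : Type*} [NormedAddCommGroup F] [NormedSpace ℝ F] {f : ℝ → E3 → F}
    {n : WithTop ℕ∞} (h : ContDiffAt ℝ n (fun q : ℝ × E3 => f q.1 q.2) (t, x)) :
    ContDiffAt ℝ n (f t) x :=
  h.comp x (contDiffAt_const.prodMk contDiffAt_id)

variable (h : ContDiffAt ℝ 2 (fun q : ℝ × E3 => f q.1 q.2) (t, x))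

include h

/-- Equality on a whole neighbourhood, not just at the point, allows a further differentiation in
time or space. -/
lemma eventually_grad_eq (i j : Fin 3) :
    (fun q : ℝ × E3 => grad (f q.1) q.2 i j) =ᶠ[𝓝 (t, x)] fun q =>
      fderiv ℝ (fun q : ℝ × E3 => f q.1 q.2) q (0, EuclideanSpace.single j 1) i := by
  filter_upwards [h.eventually (by norm_num)] with q hq
  have := hasFDerivAt_slice (f := f) (t := q.1) (x := q.2) (hq.differentiableAt (by norm_num))
  rw [grad_apply, this.fderiv]
  rfl

lemma eventually_deriv_eq :
    (fun q : ℝ × E3 => deriv (fun s => f s q.2) q.1) =ᶠ[𝓝 (t, x)] fun q =>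
      fderiv ℝ (fun q : ℝ × E3 => f q.1 q.2) q (1, 0) := by
  filter_upwards [h.eventually (by norm_num)] with q hq
  exact (hasDerivAt_slice (f := f) (t := q.1) (x := q.2) (hq.differentiableAt (by norm_num))).deriv

lemma contDiffAt_grad (i j : Fin 3) :
    ContDiffAt ℝ 1 (fun q : ℝ × E3 => grad (f q.1) q.2 i j) (t, x) :=
  ((coordL i).contDiff.contDiffAt.comp (t, x) ((h.fderiv_right (m := 1) (by norm_num)).clm_apply
    contDiffAt_const)).congr_of_eventuallyEq (eventually_grad_eq h i j)

lemma contDiffAt_deriv :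
    ContDiffAt ℝ 1 (fun q : ℝ × E3 => deriv (fun s => f s q.2) q.1) (t, x) :=
  ((h.fderiv_right (m := 1) (by norm_num)).clm_apply
    contDiffAt_const).congr_of_eventuallyEq (eventually_deriv_eq h)

/-- Exchange of the time derivative and the gradient. -/
lemma hasDerivAt_grad (i j : Fin 3) :
    HasDerivAt (fun s => grad (f s) x i j) (grad (fun y => deriv (fun s => f s y) t) x i j) t := by
  set Λ : ℝ × E3 → E3 := fun q => f q.1 q.2 with hΛ
  have hA : DifferentiableAt ℝ (fderiv ℝ Λ) (t, x) :=
    (h.fderiv_right (m := 1) (by norm_num)).differentiableAt (by norm_num)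
  have hsym : IsSymmSndFDerivAt ℝ Λ (t, x) := h.isSymmSndFDerivAt (by simp)
  have h1 : HasDerivAt (fun s : ℝ => (s, x)) ((1 : ℝ), (0 : E3)) t :=
    (hasDerivAt_id t).prodMk (hasDerivAt_const t x)
  have h2 : HasFDerivAt (fun y : E3 => (t, y)) (ContinuousLinearMap.inr ℝ ℝ E3) x :=
    hasFDerivAt_prodMk_right t x
  have ev : ∀ b : ℝ × E3, HasFDerivAt (fun q => fderiv ℝ Λ q b)
      ((ContinuousLinearMap.apply ℝ E3 b).comp (fderiv ℝ (fderiv ℝ Λ) (t, x))) (t, x) := fun b =>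
    (ContinuousLinearMap.apply ℝ E3 b).hasFDerivAt.comp (t, x) hA.hasFDerivAt
  have e1 : HasDerivAt (fun s => grad (f s) x i j)
      (fderiv ℝ (fderiv ℝ Λ) (t, x) (1, 0) (0, EuclideanSpace.single j 1) i) t := by
    have := (coordL i).hasFDerivAt.comp_hasDerivAt t
      ((ev (0, EuclideanSpace.single j 1)).comp_hasDerivAt t h1)
    exact this.congr_of_eventuallyEq
      ((show ContinuousAt (fun s : ℝ => (s, x)) t from h1.continuousAt).eventually
        (eventually_grad_eq h i j))
  have e2 : HasFDerivAt (fun y => deriv (fun s => f s y) t)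
      (((ContinuousLinearMap.apply ℝ E3 ((1 : ℝ), (0 : E3))).comp
        (fderiv ℝ (fderiv ℝ Λ) (t, x))).comp (ContinuousLinearMap.inr ℝ ℝ E3)) x :=
    ((ev (1, 0)).comp x h2).congr_of_eventuallyEq
      ((show ContinuousAt (fun y : E3 => (t, y)) x from h2.continuousAt).eventually
        (eventually_deriv_eq h))
  rw [grad_apply, e2.fderiv]
  have : (((ContinuousLinearMap.apply ℝ E3 ((1 : ℝ), (0 : E3))).comp
        (fderiv ℝ (fderiv ℝ Λ) (t, x))).comp (ContinuousLinearMap.inr ℝ ℝ E3))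
        (EuclideanSpace.single j 1) =
      fderiv ℝ (fderiv ℝ Λ) (t, x) (1, 0) (0, EuclideanSpace.single j 1) := by
    rw [hsym]; rfl
  rw [this]
  exact e1

end SpaceTime

/-! ### Kinematics of the reference and transport of kinetic energy. -/

namespace Reference

variable {S : Reference} {t : ℝ} {x : E3}

lemma contDiffAt_lam (ht : S.t₀ ≤ t) (hx : x ∈ closure S.Ω) : ContDiffAt ℝ 2 (S.lam t) x :=
  contDiffAt_slice (S.smooth t ht x hx)

lemma contDiffAt_F (ht : S.t₀ ≤ t) (hx : x ∈ closure S.Ω) (i j : Fin 3) :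
    ContDiffAt ℝ 1 (fun q : ℝ × E3 => S.F q.1 q.2 i j) (t, x) :=
  contDiffAt_grad (S.smooth t ht x hx) i j

lemma contDiffAt_J (ht : S.t₀ ≤ t) (hx : x ∈ closure S.Ω) :
    ContDiffAt ℝ 1 (fun q : ℝ × E3 => S.J q.1 q.2) (t, x) :=
  contDiffAt_det (n := 1) fun i j => contDiffAt_F ht hx i j

lemma contDiffAt_vref (ht : S.t₀ ≤ t) (hx : x ∈ closure S.Ω) : ContDiffAt ℝ 1 (S.vref t) x :=
  contDiffAt_slice (f := S.vref) (contDiffAt_deriv (S.smooth t ht x hx))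

lemma J_pos (ht : S.t₀ ≤ t) (hx : x ∈ closure S.Ω) : 0 < S.J t x := S.det_pos t ht x hx

lemma adjugate_F (ht : S.t₀ ≤ t) (hx : x ∈ closure S.Ω) :
    (S.F t x).adjugate = S.J t x • (S.F t x)⁻¹ := by
  have h := (J_pos ht hx).ne'
  rw [Matrix.inv_def, Ring.inverse_eq_inv', smul_smul, J]
  rw [J] at h
  rw [mul_inv_cancel₀ h, one_smul]

/-- Euler's expansion formula. -/
lemma hasDerivAt_J (ht : S.t₀ ≤ t) (hx : x ∈ closure S.Ω) :
    HasDerivAt (fun s => S.J s x)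
      (∑ j, ∑ i, (S.F t x).adjugate j i * grad (S.vref t) x i j) t :=
  hasDerivAt_det fun i j => hasDerivAt_grad (S.smooth t ht x hx) i j

lemma isCompact_closure (S : Reference) : IsCompact (closure S.Ω) := S.bounded.isCompact_closure

lemma integrableOn_of_continuousOn {E : Type*} [NormedAddCommGroup E] {f : E3 → E}
    (hf : ContinuousOn f (closure S.Ω)) : IntegrableOn f S.Ω :=
  (hf.integrableOn_compact S.isCompact_closure).mono_set subset_closure

section Transport

variable {v : E3 → E3}

lemma act_smul_left (c : ℝ) (A : Matrix (Fin 3) (Fin 3) ℝ) (u : E3) : act (c • A) u = c • act A u := by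
  ext i; simp [act, Matrix.smul_mulVec]

lemma act_mul (A B : Matrix (Fin 3) (Fin 3) ℝ) (u : E3) : act (A * B) u = act A (act B u) := by
  ext i; simp [act, Matrix.mulVec_mulVec]

lemma inner_act (A : Matrix (Fin 3) (Fin 3) ℝ) (u w : E3) :
    inner ℝ (act A u) w = inner ℝ (act A.transpose w) u := by
  simp only [inner_eq_sum, act_apply, Matrix.transpose_apply, Fin.sum_univ_three]; ring

/-- The flux of `|v|² / 2` relative to the reference. -/
noncomputable def energyFlux (S : Reference) (t : ℝ) (v : E3 → E3) (x : E3) : E3 :=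
  (1 / 2 * ‖v x‖ ^ 2) • act (S.F t x).adjugate (v x - S.vref t x)

lemma contDiffAt_adjugate_F (ht : S.t₀ ≤ t) (hx : x ∈ closure S.Ω) (i j : Fin 3) :
    ContDiffAt ℝ 1 (fun y => (S.F t y).adjugate i j) x :=
  contDiffAt_adjugate (n := 1) (fun i j => contDiffAt_slice (f := fun s y => S.F s y i j)
    (contDiffAt_F ht hx i j)) i j

lemma contDiffAt_energyFlux (ht : S.t₀ ≤ t) (hx : x ∈ closure S.Ω) (hv : ContDiffAt ℝ 1 v x) :
    ContDiffAt ℝ 1 (S.energyFlux t v) x := by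
  refine (contDiffAt_const.mul (hv.norm_sq ℝ)).smul ?_
  rw [contDiffAt_euclidean]
  intro i
  simp only [act_apply]
  refine ContDiffAt.sum fun j _ => (contDiffAt_adjugate_F ht hx i j).mul ?_
  exact (coordL j).contDiff.contDiffAt.comp x (hv.sub (contDiffAt_vref ht hx))

/-- Piola's identity leaves two terms. Differentiating `|v|² / 2` gives the convective power;
differentiating `v - vref` gives `adj F` contracted with its gradient. There the part from `v`
vanishes by incompressibility, and the part from `vref` is Euler's formula for the rate of `J`. -/
lemma divergence_energyFlux (ht : S.t₀ ≤ t) (hx : x ∈ S.Ω) (hv : ContDiffAt ℝ 1 v x)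
    (hinc : S.Incompressible t v) :
    divergence (S.energyFlux t v) x =
      inner ℝ (v x) (act (S.sgrad t v x) (v x - S.vref t x)) * S.J t x -
        1 / 2 * ‖v x‖ ^ 2 * deriv (fun s => S.J s x) t := by
  have hx' : x ∈ closure S.Ω := subset_closure hx
  have hvd : DifferentiableAt ℝ v x := hv.differentiableAt (by norm_num)
  have hwd : DifferentiableAt ℝ (S.vref t) x :=
    (contDiffAt_vref ht hx').differentiableAt (by norm_num)
  have hgd : HasFDerivAt (fun y => 1 / 2 * ‖v y‖ ^ 2)
      ((1 / 2 : ℝ) • (2 • (innerSL ℝ (v x)).comp (fderiv ℝ v x))) x :=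
    (hvd.hasFDerivAt.norm_sq).const_mul _
  have hmain := divergence_smul_act (u := fun y => v y - S.vref t y) hgd.differentiableAt
    (fun i j => (contDiffAt_adjugate_F ht hx' i j).differentiableAt (by norm_num))
    (hvd.sub hwd) (fun i => sum_fderiv_adjugate_grad (contDiffAt_lam ht hx') i)
  have hgr : ∀ i j, grad (fun y => v y - S.vref t y) x i j =
      grad v x i j - grad (S.vref t) x i j := fun i j => by
    simp only [grad_apply]; rw [fderiv_fun_sub hvd hwd]; rfl
  have hz : ∑ j, ∑ i, (S.F t x).adjugate j i * grad v x i j = 0 := by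
    have := hinc x hx
    rw [ddot, Finset.sum_comm] at this
    rw [adjugate_F ht hx']
    calc _ = S.J t x * ∑ j, ∑ i, grad v x i j * ((S.F t x)⁻¹).transpose i j := by
          simp only [Finset.mul_sum, Matrix.smul_apply, Matrix.transpose_apply, smul_eq_mul]
          refine Finset.sum_congr rfl fun j _ => Finset.sum_congr rfl fun i _ => by ring
      _ = 0 := by rw [this, mul_zero]
  show divergence (fun y => (1 / 2 * ‖v y‖ ^ 2) • act (S.F t y).adjugate (v y - S.vref t y)) x = _
  rw [(hasDerivAt_J ht hx').deriv, hmain, hgd.fderiv]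
  simp only [hgr, mul_sub, Finset.sum_sub_distrib, hz]
  rw [adjugate_F ht hx', act_smul_left, sgrad, act_mul, act_grad]
  simp
  ring

/-- Moves the flux onto the conormal `F⁻ᵗ N`, in terms of which the wall conditions are stated. -/
lemma inner_energyFlux (ht : S.t₀ ≤ t) (hx : x ∈ closure S.Ω) (N : E3) :
    inner ℝ (S.energyFlux t v x) N = 1 / 2 * ‖v x‖ ^ 2 * (S.J t x *
      inner ℝ (act ((S.F t x)⁻¹).transpose N) (v x - S.vref t x)) := by
  rw [energyFlux, inner_smul_left, adjugate_F ht hx, act_smul_left, inner_smul_left, inner_act]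
  simp

/-- The transport theorem for the kinetic energy: the convective power balances the change of the
volume element. -/
theorem integral_convective (ht : S.t₀ ≤ t) (hv : ∀ x ∈ closure S.Ω, ContDiffAt ℝ 1 v x)
    (hinc : S.Incompressible t v) (himp : S.Impermeable t v)
    (hfree : ∀ x ∈ S.free, S.vref t x = v x) :
    ∫ x in S.Ω, inner ℝ (v x) (act (S.sgrad t v x) (v x - S.vref t x)) * S.J t x =
      ∫ x in S.Ω, 1 / 2 * ‖v x‖ ^ 2 * deriv (fun s => S.J s x) t := by
  have h0 := setIntegral_divergence_eq_zero S.isOpen S.bounded S.lipschitz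
    (G := S.energyFlux t v) (fun x hx => contDiffAt_energyFlux ht hx (hv x hx)) (by
      intro z hz N hN
      have hzc : z ∈ closure S.Ω := frontier_subset_closure hz
      rw [inner_energyFlux ht hzc]
      rw [← S.boundary] at hz
      rcases hz with hz | hz
      · rw [hfree z hz, sub_self, inner_zero_right]; ring
      · have e1 := himp z hz N hN
        have e2 := S.wall_fixed t ht z hz N hN
        rw [inner_sub_right, e1]
        erw [e2]
        ring)
  have hi1 : IntegrableOn (divergence (S.energyFlux t v)) S.Ω :=
    integrableOn_of_continuousOn (continuousOn_divergence
      fun x hx => contDiffAt_energyFlux ht hx (hv x hx))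
  have hi2 : IntegrableOn (fun x => 1 / 2 * ‖v x‖ ^ 2 * deriv (fun s => S.J s x) t) S.Ω := by
    refine integrableOn_of_continuousOn ?_
    have hvc : ContinuousOn v (closure S.Ω) := fun x hx =>
      (hv x hx).continuousAt.continuousWithinAt
    refine (continuousOn_const.mul (hvc.norm.pow 2)).mul ?_
    refine ContinuousOn.congr (f := fun x =>
      ∑ j, ∑ i, (S.F t x).adjugate j i * grad (S.vref t) x i j) ?_
      fun x hx => (hasDerivAt_J ht hx).deriv
    refine continuousOn_finsetSum _ fun j _ => continuousOn_finsetSum _ fun i _ => fun x hx => ?_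
    refine ((contDiffAt_adjugate_F ht hx j i).continuousAt.mul ?_).continuousWithinAt
    exact (coordL i).continuous.continuousAt.comp
      (((contDiffAt_vref ht hx).continuousAt_fderiv (by norm_num)).clm_apply continuousAt_const)
  have e : ∀ x ∈ S.Ω, inner ℝ (v x) (act (S.sgrad t v x) (v x - S.vref t x)) * S.J t x =
      divergence (S.energyFlux t v) x + 1 / 2 * ‖v x‖ ^ 2 * deriv (fun s => S.J s x) t :=
    fun x hx => by
      have := divergence_energyFlux ht hx (hv x (subset_closure hx)) hinc
      rw [this]; ring
  rw [setIntegral_congr_fun S.isOpen.measurableSet e, integral_add hi1 hi2, h0, zero_add]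

end Transport

end Reference

/-! ### Integral tools: Young's inequality and differentiation under the integral. -/

/-- Young's inequality for a weighted integral of an inner product. -/
lemma integral_inner_mul_le {α : Type*} [MeasurableSpace α] {m : Measure α} {f g : α → E3}
    {c : α → ℝ} {κ : ℝ} (hκ : 0 < κ) (hc : ∀ᵐ x ∂m, 0 ≤ c x)
    (hf : Integrable (fun x => ‖f x‖ ^ 2 * c x) m) (hg : Integrable (fun x => ‖g x‖ ^ 2 * c x) m) :
    ∫ x, inner ℝ (f x) (g x) * c x ∂m ≤
      κ / 2 * ∫ x, ‖f x‖ ^ 2 * c x ∂m + 1 / (2 * κ) * ∫ x, ‖g x‖ ^ 2 * c x ∂m := by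
  rw [← integral_const_mul, ← integral_const_mul, ← integral_add (hf.const_mul _) (hg.const_mul _)]
  by_cases hi : Integrable (fun x => inner ℝ (f x) (g x) * c x) m
  · refine integral_mono_ae hi ((hf.const_mul _).add (hg.const_mul _)) ?_
    filter_upwards [hc] with x hx
    have h1 : inner ℝ (f x) (g x) ≤ κ / 2 * ‖f x‖ ^ 2 + 1 / (2 * κ) * ‖g x‖ ^ 2 := by
      refine (real_inner_le_norm _ _).trans ?_
      have h2 : κ / 2 * ‖f x‖ ^ 2 + 1 / (2 * κ) * ‖g x‖ ^ 2 - ‖f x‖ * ‖g x‖ =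
          (κ * ‖f x‖ - ‖g x‖) ^ 2 / (2 * κ) := by field_simp; ring
      have h3 : 0 ≤ (κ * ‖f x‖ - ‖g x‖) ^ 2 / (2 * κ) := by positivity
      linarith
    calc _ ≤ (κ / 2 * ‖f x‖ ^ 2 + 1 / (2 * κ) * ‖g x‖ ^ 2) * c x :=
          mul_le_mul_of_nonneg_right h1 hx
      _ = _ := by ring
  -- Without integrability the left side is zero by convention, and the right side is nonnegative.
  · rw [integral_undef hi]
    refine integral_nonneg_of_ae ?_
    filter_upwards [hc] with x hx
    simp only [Pi.zero_apply]
    positivity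

/-- Differentiation under the integral over a bounded domain, for an integrand that is `C¹` up to
the boundary. -/
lemma hasDerivAt_setIntegral {Ω : Set E3} (ho : IsOpen Ω) (hb : Bornology.IsBounded Ω)
    {f : ℝ → E3 → ℝ} {t : ℝ}
    (hf : ∀ x ∈ closure Ω, ContDiffAt ℝ 1 (fun q : ℝ × E3 => f q.1 q.2) (t, x)) :
    IntegrableOn (fun x => deriv (fun s => f s x) t) Ω ∧
      HasDerivAt (fun s => ∫ x in Ω, f s x) (∫ x in Ω, deriv (fun s => f s x) t) t := by
  set Φ : ℝ × E3 → ℝ := fun q => f q.1 q.2 with hΦ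
  have hK : IsCompact (closure Ω) := hb.isCompact_closure
  have hslice : ∀ s x, ContDiffAt ℝ 1 Φ (s, x) →
      HasDerivAt (fun s => f s x) (fderiv ℝ Φ (s, x) (1, 0)) s := fun s x h => by
    have h1 : HasDerivAt (fun s : ℝ => (s, x)) ((1 : ℝ), (0 : E3)) s :=
      (hasDerivAt_id s).prodMk (hasDerivAt_const s x)
    exact (h.differentiableAt (by norm_num)).hasFDerivAt.comp_hasDerivAt s h1
  have hcd : ∀ x ∈ closure Ω, ContinuousAt (fun q => fderiv ℝ Φ q (1, 0)) (t, x) := fun x hx =>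
    ((hf x hx).continuousAt_fderiv (by norm_num)).clm_apply continuousAt_const
  have hcs : ContinuousOn (fun x => fderiv ℝ Φ (t, x) (1, 0)) (closure Ω) := fun x hx =>
    ((hcd x hx).comp (f := fun y : E3 => (t, y)) (by fun_prop)).continuousWithinAt
  obtain ⟨M, hM⟩ := hK.exists_bound_of_continuousOn hcs
  -- Compactness of the closure provides one time neighbourhood for all `x`. `M` bounds the time
  -- derivative at `t` itself; the extra 1 is the margin for nearby times.
  have hev : ∀ᶠ s in 𝓝 t, ∀ x ∈ closure Ω,
      ContDiffAt ℝ 1 Φ (s, x) ∧ ‖fderiv ℝ Φ (s, x) (1, 0)‖ < M + 1 := by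
    refine hK.eventually_forall_of_forall_eventually fun x hx => ?_
    refine ((hf x hx).eventually (by norm_num)).and ?_
    exact (hcd x hx).norm.eventually (gt_mem_nhds ((hM x hx).trans_lt (lt_add_one M)))
  have hcont : ∀ s, (∀ x ∈ closure Ω,
      ContDiffAt ℝ 1 Φ (s, x) ∧ ‖fderiv ℝ Φ (s, x) (1, 0)‖ < M + 1) →
      ContinuousOn (f s) (closure Ω) := fun s hs x hx =>
    (contDiffAt_slice (hs x hx).1).continuousAt.continuousWithinAt
  have hΩfin : volume Ω ≠ ⊤ := hb.measure_lt_top.ne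
  have hmain := hasDerivAt_integral_of_dominated_loc_of_deriv_le (μ := volume.restrict Ω)
    (F := f) (F' := fun s x => fderiv ℝ Φ (s, x) (1, 0)) (bound := fun _ => M + 1) hev
    (hev.mono fun s hs => ((hcont s hs).mono subset_closure).aestronglyMeasurable ho.measurableSet)
    (((hcont t hev.self_of_nhds).integrableOn_compact hK).mono_set subset_closure)
    ((hcs.mono subset_closure).aestronglyMeasurable ho.measurableSet)
    ((ae_restrict_mem ho.measurableSet).mono fun x hx s hs => (hs x (subset_closure hx)).2.le)
    (integrableOn_const hΩfin)
    ((ae_restrict_mem ho.measurableSet).mono fun x hx s hs =>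
      hslice s x (hs x (subset_closure hx)).1)
  have heq : EqOn (fun x => fderiv ℝ Φ (t, x) (1, 0)) (fun x => deriv (fun s => f s x) t) Ω :=
    fun x hx => (hslice t x (hf x (subset_closure hx))).deriv.symm
  rw [← setIntegral_congr_fun ho.measurableSet heq]
  exact ⟨IntegrableOn.congr_fun hmain.1 heq ho.measurableSet, hmain.2⟩

/-! ### Energy balance and the differential inequality. -/

namespace Reference

variable {S : Reference} {ρ μ C M : ℝ} {v : ℝ → E3 → E3} {p : ℝ → E3 → ℝ} {b : ℝ → E3 → E3} {t : ℝ}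

lemma continuousOn_J (ht : S.t₀ ≤ t) : ContinuousOn (S.J t) (closure S.Ω) := fun _ hx =>
  (contDiffAt_slice (contDiffAt_J ht hx)).continuousAt.continuousWithinAt

lemma IsFlow.contDiffAt_space (h : S.IsFlow ρ μ v p b) (ht : S.t₀ ≤ t) :
    ∀ x ∈ closure S.Ω, ContDiffAt ℝ 1 (v t) x := fun x hx =>
  contDiffAt_slice (h.smooth t ht x hx)

lemma IsFlow.admissible (h : S.IsFlow ρ μ v p b) (ht : S.t₀ ≤ t) : S.Admissible t (v t) where
  smooth := h.contDiffAt_space ht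
  incompressible := h.incompressible t ht
  impermeable := h.impermeable t ht
  at_rest := h.at_rest t ht

/-- The balance of kinetic energy. -/
theorem IsFlow.hasDerivAt_K (h : S.IsFlow ρ μ v p b) (hL : S.LagrangianAtFree v)
    (ht : S.t₀ ≤ t) :
    HasDerivAt (S.K ρ v) (ρ * (∫ x in S.Ω, inner ℝ (v t x) (b t x) * S.J t x) -
      2 * μ * (∫ x in S.Ω, ddot (S.D t (v t) x) (S.D t (v t) x) * S.J t x) +
      ∫ x, inner ℝ (v t x) (S.traction μ v p t x) ∂(surf S.Ω)) t := by
  have hv := h.contDiffAt_space ht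
  have hsq : ∀ x ∈ closure S.Ω,
      ContDiffAt ℝ 1 (fun q : ℝ × E3 => ‖v q.1 q.2‖ ^ 2 * S.J q.1 q.2) (t, x) := fun x hx =>
    ((h.smooth t ht x hx).norm_sq ℝ).mul (contDiffAt_J ht hx)
  obtain ⟨hi, hd⟩ := hasDerivAt_setIntegral S.isOpen S.bounded
    (f := fun s x => ‖v s x‖ ^ 2 * S.J s x) hsq
  obtain ⟨hiJ, -⟩ := hasDerivAt_setIntegral S.isOpen S.bounded
    (f := S.J) fun x hx => contDiffAt_J ht hx
  have hvc : ContinuousOn (v t) (closure S.Ω) := fun x hx =>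
    (hv x hx).continuousAt.continuousWithinAt
  have hi2 : IntegrableOn (fun x => 1 / 2 * ‖v t x‖ ^ 2 * deriv (fun s => S.J s x) t) S.Ω := by
    refine (hiJ.mul_continuousOn_of_subset (continuousOn_const.mul (hvc.norm.pow 2))
      S.isOpen.measurableSet S.isCompact_closure subset_closure (g' := fun x => 1 / 2 * ‖v t x‖ ^ 2)
      ).congr (ae_of_all _ fun x => ?_)
    exact mul_comm _ _
  -- The product rule; the subtracted term is exactly what the convective power restores.
  have hpt : ∀ x ∈ S.Ω, inner ℝ (v t x) (deriv (fun s => v s x) t) * S.J t x =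
      1 / 2 * deriv (fun s => ‖v s x‖ ^ 2 * S.J s x) t -
        1 / 2 * ‖v t x‖ ^ 2 * deriv (fun s => S.J s x) t := fun x hx => by
    have hx' := subset_closure hx
    have h1 := hasDerivAt_slice ((h.smooth t ht x hx').differentiableAt (by norm_num))
    have h2 := (h1.norm_sq.mul (hasDerivAt_J ht hx')).deriv
    have h3 : deriv (fun s => ‖v s x‖ ^ 2 * S.J s x) t = _ := h2
    rw [h3, h1.deriv, (hasDerivAt_J ht hx').deriv]
    ring
  have hP : ∫ x in S.Ω, p t x * ddot (grad (v t) x) ((S.F t x)⁻¹).transpose * S.J t x = 0 :=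
    setIntegral_eq_zero_of_forall_eq_zero fun x hx => by
      rw [h.incompressible t ht x hx]; ring
  have hmom := h.momentum t ht (v t) hv
  unfold Momentum at hmom
  rw [hP, integral_convective ht hv (h.incompressible t ht) (h.impermeable t ht)
    (hL t ht), setIntegral_congr_fun S.isOpen.measurableSet hpt,
    integral_sub (hi.const_mul _) hi2, integral_const_mul] at hmom
  have hK : HasDerivAt (S.K ρ v)
      (1 / 2 * ρ * ∫ x in S.Ω, deriv (fun s => ‖v s x‖ ^ 2 * S.J s x) t) t := hd.const_mul _
  refine hK.congr_deriv ?_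
  linarith

/-- The differential inequality for the kinetic energy. -/
theorem IsFlow.deriv_K_le (h : S.IsFlow ρ μ v p b) (hρ : 0 < ρ) (hμ : 0 < μ)
    (hC : S.IsPoincareKornConstant C) (hL : S.LagrangianAtFree v)
    (hM : S.LoadBound ρ μ C M v p b) (ht : S.t₀ ≤ t) :
    deriv (S.K ρ v) t ≤ -(μ / ρ * C) * S.K ρ v t + M ^ 2 / (2 * (μ / ρ * C)) := by
  rw [(h.hasDerivAt_K hL ht).deriv]
  obtain ⟨hC0, hCt⟩ := hC
  obtain ⟨hPt, hvΓ, hb⟩ := hM t ht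
  have hκ : 0 < μ / ρ * C := by positivity
  set κ := μ / ρ * C with hκd
  have hJc := continuousOn_J ht
  have hv := h.contDiffAt_space ht
  have hvc : ContinuousOn (v t) (closure S.Ω) := fun x hx =>
    (hv x hx).continuousAt.continuousWithinAt
  have hiv : IntegrableOn (fun x => ‖v t x‖ ^ 2 * S.J t x) S.Ω :=
    integrableOn_of_continuousOn ((hvc.norm.pow 2).mul hJc)
  have hib : IntegrableOn (fun x => ‖b t x‖ ^ 2 * S.J t x) S.Ω :=
    IntegrableOn.mul_continuousOn_of_subset
      ((h.force t ht).integrable_norm_pow (p := 2) (by norm_num)) hJc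
      S.isOpen.measurableSet S.isCompact_closure subset_closure
  -- The dissipation is at least `ρ κ X`. Weight `κ` makes the force cost half of that, leaving `-κ
  -- K`. On the boundary the same weight produces `VΓ` and `PΓ` in the proportion in which the load
  -- bound contains them.
  have hforce := integral_inner_mul_le (f := v t) (g := b t) hκ
    ((ae_restrict_mem S.isOpen.measurableSet).mono fun x hx =>
      (J_pos ht (subset_closure hx)).le) hiv hib
  have htrac := integral_inner_mul_le (m := surf S.Ω) (f := v t) (g := S.traction μ v p t)
    (c := fun _ => 1) hκ (ae_of_all _ fun _ => zero_le_one)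
    (by simpa using hvΓ.integrable_norm_pow (p := 2) (by norm_num))
    (by simpa using hPt.integrable_norm_pow (p := 2) (by norm_num))
  simp only [mul_one] at htrac
  have hkorn := hCt t ht (v t) (h.admissible ht)
  set X := ∫ x in S.Ω, ‖v t x‖ ^ 2 * S.J t x with hX
  set B := ∫ x in S.Ω, ‖b t x‖ ^ 2 * S.J t x
  set VΓ := ∫ x, ‖v t x‖ ^ 2 ∂(surf S.Ω)
  set PΓ := ∫ x, ‖S.traction μ v p t x‖ ^ 2 ∂(surf S.Ω)
  have hKX : S.K ρ v t = 1 / 2 * ρ * X := rfl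
  have hb' : ρ * B + PΓ + κ ^ 2 * VΓ ≤ M ^ 2 := by rw [hκd, mul_pow]; exact hb
  have h1 := mul_le_mul_of_nonneg_left hforce hρ.le
  have h2 := mul_le_mul_of_nonneg_left hkorn (by positivity : 0 ≤ 2 * μ)
  have h3 : (ρ * B + PΓ + κ ^ 2 * VΓ) / (2 * κ) ≤ M ^ 2 / (2 * κ) := by gcongr
  have h4 : (ρ * B + PΓ + κ ^ 2 * VΓ) / (2 * κ) =
      ρ * (1 / (2 * κ) * B) + 1 / (2 * κ) * PΓ + κ / 2 * VΓ := by field_simp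
  have h5 : μ * C = ρ * κ := by rw [hκd]; field_simp
  have h6 : 2 * μ * (C / 2 * X) = ρ * κ * X := by rw [← h5]; ring
  rw [hKX]
  rw [h6] at h2
  rw [h4] at h3
  linarith

end Reference

/-! ### Gronwall's inequality and the long-time limit. -/

/-- Gronwall's inequality for `f' ≤ -κ f + κ A`. -/
lemma le_exp_decay_of_deriv_le {f : ℝ → ℝ} {t₀ κ A : ℝ}
    (hf : ∀ t, t₀ ≤ t → DifferentiableAt ℝ f t)
    (hd : ∀ t, t₀ ≤ t → deriv f t ≤ -κ * f t + κ * A) {t : ℝ} (ht : t₀ ≤ t) :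
    f t ≤ Real.exp (-(κ * (t - t₀))) * f t₀ + (1 - Real.exp (-(κ * (t - t₀)))) * A := by
  -- With this integrating factor, the differential inequality says that `g' ≤ 0`.
  set g : ℝ → ℝ := fun s => Real.exp (κ * (s - t₀)) * (f s - A) with hg
  have hgd : ∀ s, t₀ ≤ s → HasDerivAt g
      (Real.exp (κ * (s - t₀)) * κ * (f s - A) + Real.exp (κ * (s - t₀)) * deriv f s) s :=
    fun s hs => by
      have h1 : HasDerivAt (fun s => κ * (s - t₀)) κ s := by
        simpa using ((hasDerivAt_id s).sub_const t₀).const_mul κ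
      exact h1.exp.mul ((hf s hs).hasDerivAt.sub_const A)
  have hanti : AntitoneOn g (Ici t₀) := by
    refine antitoneOn_of_deriv_nonpos (convex_Ici t₀)
      (fun s hs => (hgd s hs).continuousAt.continuousWithinAt) (fun s hs => ?_) fun s hs => ?_
    · rw [interior_Ici] at hs
      exact (hgd s (le_of_lt hs)).differentiableAt.differentiableWithinAt
    · rw [interior_Ici] at hs
      rw [(hgd s (le_of_lt hs)).deriv]
      have h1 := mul_le_mul_of_nonneg_left (hd s (le_of_lt hs)) (Real.exp_pos (κ * (s - t₀))).le
      linarith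
  have h := hanti self_mem_Ici ht ht
  simp only [hg, sub_self, mul_zero, Real.exp_zero, one_mul] at h
  have h2 := mul_le_mul_of_nonneg_left h (Real.exp_pos (-(κ * (t - t₀)))).le
  rw [← mul_assoc, ← Real.exp_add, neg_add_cancel, Real.exp_zero, one_mul] at h2
  linarith

lemma limsup_le_of_exp_decay {f : ℝ → ℝ} {t₀ κ A c : ℝ} (hκ : 0 < κ)
    (h0 : ∀ t, t₀ ≤ t → 0 ≤ f t)
    (h : ∀ t, t₀ ≤ t →
      f t ≤ Real.exp (-(κ * (t - t₀))) * c + (1 - Real.exp (-(κ * (t - t₀)))) * A) :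
    limsup f atTop ≤ A := by
  have he : Tendsto (fun t : ℝ => Real.exp (-(κ * (t - t₀)))) atTop (𝓝 0) :=
    Real.tendsto_exp_neg_atTop_nhds_zero.comp
      ((tendsto_atTop_add_const_right _ (-t₀) tendsto_id).const_mul_atTop hκ)
  have hlim : Tendsto (fun t : ℝ => Real.exp (-(κ * (t - t₀))) * c +
      (1 - Real.exp (-(κ * (t - t₀)))) * A) atTop (𝓝 A) := by
    simpa using (he.mul_const c).add ((he.const_sub 1).mul_const A)
  rw [← hlim.limsup_eq]
  refine limsup_le_limsup ((eventually_ge_atTop t₀).mono h) ?_ hlim.isBoundedUnder_le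
  -- The lower bound on `f` keeps the set of eventual upper bounds bounded below, so the real
  -- `limsup` is a true infimum and not a default value.
  exact IsBoundedUnder.isCoboundedUnder_le
    ⟨0, (eventually_map.2 ((eventually_ge_atTop t₀).mono h0))⟩

namespace Reference

variable {S : Reference} {ρ μ C M : ℝ} {v : ℝ → E3 → E3} {p : ℝ → E3 → ℝ} {b : ℝ → E3 → E3} {t : ℝ}

lemma K_nonneg (hρ : 0 < ρ) (v : ℝ → E3 → E3) (ht : S.t₀ ≤ t) : 0 ≤ S.K ρ v t := by
  refine mul_nonneg (by positivity) (setIntegral_nonneg S.isOpen.measurableSet fun x hx => ?_)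
  have := J_pos ht (subset_closure hx)
  positivity

/-- Exponential decay of the kinetic energy to the level set by the loads. -/
theorem IsFlow.K_le (h : S.IsFlow ρ μ v p b) (hρ : 0 < ρ) (hμ : 0 < μ)
    (hC : S.IsPoincareKornConstant C) (hL : S.LagrangianAtFree v)
    (hM : S.LoadBound ρ μ C M v p b) (ht : S.t₀ ≤ t) :
    S.K ρ v t ≤ Real.exp (-(μ / ρ * C * (t - S.t₀))) * S.K ρ v S.t₀ +
      (1 - Real.exp (-(μ / ρ * C * (t - S.t₀)))) * (M ^ 2 / (2 * (μ / ρ) ^ 2 * C ^ 2)) := by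
  refine le_exp_decay_of_deriv_le (fun s hs => (h.hasDerivAt_K hL hs).differentiableAt)
    (fun s hs => (h.deriv_K_le hρ hμ hC hL hM hs).trans_eq ?_) ht
  have := hC.1
  congr 1
  field_simp

end Reference

/-! ### Korn's inequality on regions star-shaped about a ball. -/

/-- The symmetric part of the gradient of a vector field. -/
noncomputable def symGrad (u : E3 → E3) (x : E3) : Matrix (Fin 3) (Fin 3) ℝ :=
  (1 / 2 : ℝ) • (grad u x + (grad u x).transpose)

lemma ddot_self_nonneg (A : Matrix (Fin 3) (Fin 3) ℝ) : 0 ≤ ddot A A :=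
  Finset.sum_nonneg fun _ _ => Finset.sum_nonneg fun _ _ => mul_self_nonneg _

/-- Cauchy–Schwarz for the matrix inner product of `h ⊗ h` and `A`. -/
lemma inner_act_sq_le (A : Matrix (Fin 3) (Fin 3) ℝ) (h : E3) :
    (inner ℝ h (act A h)) ^ 2 ≤ ‖h‖ ^ 4 * ddot A A := by
  have hh : ‖h‖ ^ 2 = ∑ i, h i ^ 2 := by
    rw [← real_inner_self_eq_norm_sq, inner_eq_sum]; simp only [sq]
  have h4 : ‖h‖ ^ 4 = ∑ q : Fin 3 × Fin 3, (h q.1 * h q.2) ^ 2 := by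
    rw [Fintype.sum_prod_type, show ‖h‖ ^ 4 = ‖h‖ ^ 2 * ‖h‖ ^ 2 by ring, hh, Finset.sum_mul_sum]
    simp only [mul_pow]
  have hA : ddot A A = ∑ q : Fin 3 × Fin 3, A q.1 q.2 ^ 2 := by
    rw [Fintype.sum_prod_type, ddot]; simp only [sq]
  have hi : inner ℝ h (act A h) = ∑ q : Fin 3 × Fin 3, (h q.1 * h q.2) * A q.1 q.2 := by
    rw [Fintype.sum_prod_type, inner_eq_sum]
    simp only [act_apply, Finset.mul_sum]
    refine Finset.sum_congr rfl fun i _ => Finset.sum_congr rfl fun j _ => by ring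
  rw [h4, hA, hi]
  exact Finset.sum_mul_sq_le_sq_mul_sq _ _ _

/-- A quadratic form does not see the antisymmetric part of its matrix. This is why the rate of
deformation alone suffices. -/
lemma inner_fderiv_eq_symGrad (u : E3 → E3) (x h : E3) :
    inner ℝ h (fderiv ℝ u x h) = inner ℝ h (act (symGrad u x) h) := by
  rw [← act_grad]
  simp only [inner_eq_sum, act_apply, symGrad, Matrix.smul_apply, Matrix.add_apply,
    Matrix.transpose_apply, Fin.sum_univ_three, smul_eq_mul]
  ring

lemma continuousOn_ddot_self {s : Set E3} {A : E3 → Matrix (Fin 3) (Fin 3) ℝ}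
    (h : ContinuousOn A s) : ContinuousOn (fun x => ddot (A x) (A x)) s := by
  unfold ddot
  refine continuousOn_finsetSum _ fun i _ => continuousOn_finsetSum _ fun j _ => ?_
  have : ContinuousOn (fun x => A x i j) s :=
    (continuous_apply_apply (ρ := fun _ _ => ℝ) i j).comp_continuousOn h
  exact this.mul this

lemma continuousOn_symGrad {s : Set E3} {u : E3 → E3} (h : ContinuousOn (grad u) s) :
    ContinuousOn (symGrad u) s :=
  ContinuousOn.const_smul
    (h.add ((continuous_id.matrix_transpose).comp_continuousOn h)) (1 / 2 : ℝ)

/-- Cauchy–Schwarz on an interval of length at most 1, obtained by integrating `(f - I)² ≥ 0`. -/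
lemma sq_intervalIntegral_le {f : ℝ → ℝ} {a : ℝ} (h0 : 0 ≤ a) (h1 : a ≤ 1)
    (hf : ContinuousOn f (Icc a 1)) : (∫ s in a..1, f s) ^ 2 ≤ ∫ s in a..1, f s ^ 2 := by
  set I := ∫ s in a..1, f s with hI
  have hi1 : IntervalIntegrable f volume a 1 :=
    (uIcc_of_le h1 ▸ hf : ContinuousOn f (uIcc a 1)).intervalIntegrable
  have hi2 : IntervalIntegrable (fun s => f s ^ 2) volume a 1 :=
    (uIcc_of_le h1 ▸ hf.pow 2 : ContinuousOn (fun s => f s ^ 2) (uIcc a 1)).intervalIntegrable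
  have hpos : 0 ≤ ∫ s in a..1, (f s ^ 2 - 2 * I * f s + I ^ 2) :=
    intervalIntegral.integral_nonneg h1 fun s _ => by nlinarith [sq_nonneg (f s - I)]
  rw [intervalIntegral.integral_add (hi2.sub (hi1.const_mul _)) (by simp),
    intervalIntegral.integral_sub hi2 (hi1.const_mul _), intervalIntegral.integral_const_mul,
    intervalIntegral.integral_const, ← hI, smul_eq_mul] at hpos
  nlinarith [sq_nonneg I]

section StarShaped

variable {Λ : Set E3} {o : E3} {R : ℝ} {u : E3 → E3}

/-- Along a segment from a point of a ball on which `u` vanishes, the component of `u` in the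
direction of the segment is controlled by the rate of deformation alone. -/
lemma ofReal_inner_sq_le (hu : ∀ z ∈ Λ, DifferentiableAt ℝ u z) (hc : ContinuousOn (grad u) Λ)
    (h0 : ∀ z ∈ Metric.closedBall o R, Tendsto u (𝓝[Λ] z) (𝓝 0)) {x y : E3} {s₀ : ℝ}
    (hs₀ : 0 ≤ s₀) (hs₀1 : s₀ ≤ 1) (hx : x ∈ Λ) (hxB : x ∉ Metric.closedBall o R)
    (hstar : StarConvex ℝ y (Λ ∪ Metric.closedBall o R))
    (hys : y + s₀ • (x - y) ∈ Metric.closedBall o R) :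
    ENNReal.ofReal ((inner ℝ (x - y) (u x)) ^ 2) ≤
      ENNReal.ofReal (‖x - y‖ ^ 4) * ∫⁻ s in Ioc s₀ 1,
        Λ.indicator (fun z => ENNReal.ofReal (ddot (symGrad u z) (symGrad u z)))
          (y + s • (x - y)) := by
  set B := Metric.closedBall o R
  set γ : ℝ → E3 := fun s => y + s • (x - y) with hγ
  have hγc : Continuous γ := by fun_prop
  have hγd : ∀ s, HasDerivAt γ (x - y) s := fun s => by
    have h1 := ((hasDerivAt_id s).smul_const (x - y)).const_add y
    rw [one_smul] at h1
    exact h1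
  have hT : IsCompact (Icc (0 : ℝ) 1 ∩ γ ⁻¹' B) :=
    isCompact_Icc.inter_right (Metric.isClosed_closedBall.preimage hγc)
  -- `a` is the last time at which the segment is in the ball. Afterwards it stays in `Λ`, by
  -- star-shapedness about `y`.
  obtain ⟨a, ⟨haI, haB⟩, hamax⟩ := hT.exists_isGreatest
    ⟨s₀, ⟨hs₀, hs₀1⟩, hys⟩
  have hs₀a : s₀ ≤ a := hamax ⟨⟨hs₀, hs₀1⟩, hys⟩
  have hγ1 : γ 1 = x := by simp [hγ]
  have ha1 : a < 1 := lt_of_le_of_ne haI.2 fun h => hxB (by rw [← hγ1, ← h]; exact haB)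
  have hΛ : ∀ s ∈ Ioc a 1, γ s ∈ Λ := fun s hs => by
    have h1 : γ s ∈ Λ ∪ B :=
      starConvex_iff_segment_subset.1 hstar (Or.inl hx) (by
        rw [segment_eq_image']; exact ⟨s, ⟨haI.1.trans hs.1.le, hs.2⟩, rfl⟩)
    refine h1.resolve_right fun h => ?_
    exact absurd (hamax ⟨⟨haI.1.trans hs.1.le, hs.2⟩, h⟩) (not_le.2 hs.1)
  set h : ℝ → ℝ := fun s => inner ℝ (x - y) (u (γ s)) with hh
  set h' : ℝ → ℝ := fun s => inner ℝ (x - y) (fderiv ℝ u (γ s) (x - y)) with hh'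
  have hd : ∀ s ∈ Ioc a 1, HasDerivAt h (h' s) s := fun s hs => by
    have h1 := (hu _ (hΛ s hs)).hasFDerivAt.comp_hasDerivAt s (hγd s)
    exact ((innerSL ℝ (x - y) : E3 →L[ℝ] ℝ).hasFDerivAt).comp_hasDerivAt s h1
  have hh'c : ContinuousOn h' (Ioc a 1) := by
    have h1 : ContinuousOn (fun s => grad u (γ s)) (Ioc a 1) := hc.comp hγc.continuousOn hΛ
    have h2 : ∀ s, h' s = ∑ i, (x - y) i * ∑ j, grad u (γ s) i j * (x - y) j := fun s => by
      simp only [hh', ← act_grad, inner_eq_sum, act_apply]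
    simp only [funext h2]
    refine continuousOn_finsetSum _ fun i _ => continuousOn_const.mul
      (continuousOn_finsetSum _ fun j _ => ContinuousOn.mul ?_ continuousOn_const)
    exact (continuous_apply_apply (ρ := fun _ _ => ℝ) i j).comp_continuousOn h1
  -- The exit point `γ a` need not belong to `Λ`, and only a limit of `u` is known there; so
  -- integration starts at `s₁ > a`, and `s₁ → a` follows.
  have hstep : ∀ s₁ ∈ Ioo a 1, ENNReal.ofReal ((h 1 - h s₁) ^ 2) ≤
      ENNReal.ofReal (‖x - y‖ ^ 4) * ∫⁻ s in Ioc s₀ 1,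
        Λ.indicator (fun z => ENNReal.ofReal (ddot (symGrad u z) (symGrad u z))) (γ s) := by
    intro s₁ hs₁
    have hsub : Icc s₁ 1 ⊆ Ioc a 1 := fun s hs => ⟨hs₁.1.trans_le hs.1, hs.2⟩
    have hcI : ContinuousOn h' (Icc s₁ 1) := hh'c.mono hsub
    have hftc : ∫ s in s₁..1, h' s = h 1 - h s₁ := by
      refine intervalIntegral.integral_eq_sub_of_hasDerivAt (fun s hs => ?_) ?_
      · rw [uIcc_of_le hs₁.2.le] at hs; exact hd s (hsub hs)
      · exact (uIcc_of_le hs₁.2.le ▸ hcI : ContinuousOn h' (uIcc s₁ 1)).intervalIntegrable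
    rw [← hftc]
    calc ENNReal.ofReal ((∫ s in s₁..1, h' s) ^ 2)
        ≤ ENNReal.ofReal (∫ s in Ioc s₁ 1, h' s ^ 2) := by
          rw [← intervalIntegral.integral_of_le hs₁.2.le]
          exact ENNReal.ofReal_le_ofReal
            (sq_intervalIntegral_le (haI.1.trans hs₁.1.le) hs₁.2.le hcI)
      _ = ∫⁻ s in Ioc s₁ 1, ENNReal.ofReal (h' s ^ 2) := by
          refine ofReal_integral_eq_lintegral_ofReal ?_ (ae_of_all _ fun s => sq_nonneg _)
          exact ((hcI.pow 2).integrableOn_Icc).mono_set Ioc_subset_Icc_self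
      _ ≤ ∫⁻ s in Ioc s₁ 1, ENNReal.ofReal (‖x - y‖ ^ 4) * Λ.indicator
            (fun z => ENNReal.ofReal (ddot (symGrad u z) (symGrad u z))) (γ s) := by
          refine setLIntegral_mono' measurableSet_Ioc fun s hs => ?_
          rw [indicator_of_mem (hΛ s ⟨hs₁.1.trans hs.1, hs.2⟩),
            ← ENNReal.ofReal_mul (by positivity)]
          refine ENNReal.ofReal_le_ofReal ?_
          simp only [hh', inner_fderiv_eq_symGrad]
          exact inner_act_sq_le _ _
      _ ≤ ∫⁻ s in Ioc s₀ 1, ENNReal.ofReal (‖x - y‖ ^ 4) * Λ.indicator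
            (fun z => ENNReal.ofReal (ddot (symGrad u z) (symGrad u z))) (γ s) :=
          lintegral_mono_set (Ioc_subset_Ioc_left (hs₀a.trans hs₁.1.le))
      _ = _ := lintegral_const_mul' _ _ ENNReal.ofReal_ne_top
  have hlim : Tendsto h (𝓝[>] a) (𝓝 0) := by
    have h1 : Tendsto γ (𝓝[>] a) (𝓝[Λ] (γ a)) := by
      refine tendsto_nhdsWithin_iff.2 ⟨(hγc.tendsto a).mono_left nhdsWithin_le_nhds, ?_⟩
      filter_upwards [Ioc_mem_nhdsGT ha1] with s hs using hΛ s hs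
    have h2 := (tendsto_const_nhds (x := x - y)).inner (𝕜 := ℝ) ((h0 _ haB).comp h1)
    simpa using h2
  have hlim2 : Tendsto (fun s => ENNReal.ofReal ((h 1 - h s) ^ 2)) (𝓝[>] a)
      (𝓝 (ENNReal.ofReal ((h 1) ^ 2))) := by
    refine (ENNReal.continuous_ofReal.tendsto _).comp ?_
    simpa using (hlim.const_sub (h 1)).pow 2
  have h1x : h 1 = inner ℝ (x - y) (u x) := by simp only [hh, hγ1]
  rw [← h1x]
  refine le_of_tendsto hlim2 ?_
  filter_upwards [Ioo_mem_nhdsGT ha1] with s hs using hstep s hs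

/-- Contraction towards `y` scales volume by `s³`. The blow-up of the factor as `s → 0` is why
segments are integrated only from some `s₀ > 0`. -/
lemma lintegral_comp_segment {Φ : E3 → ENNReal} (hΦ : Measurable Φ) (y : E3) {s : ℝ} (hs : 0 < s) :
    ∫⁻ x, Φ (y + s • (x - y)) = ENNReal.ofReal (s ^ 3)⁻¹ * ∫⁻ x, Φ x := by
  have e : ∀ x, y + s • (x - y) = s • x + (y - s • y) := fun x => by rw [smul_sub]; abel
  simp only [e]
  have h1 : ∫⁻ x, Φ (s • x + (y - s • y)) =
      ∫⁻ z, Φ (z + (y - s • y)) ∂(Measure.map (fun x : E3 => s • x) volume) :=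
    (lintegral_map (hΦ.comp (measurable_add_const _)) (measurable_const_smul s)).symm
  rw [h1, Measure.map_addHaar_smul _ hs.ne', lintegral_smul_measure,
    lintegral_add_right_eq_self Φ]
  simp [abs_of_pos hs]

/-- Integrated form of the estimate along segments from one point of the ball. -/
lemma lintegral_inner_sq_le {Rmin Rmax : ℝ} (hmin : 0 < Rmin) (hmm : Rmin < Rmax)
    (hΛo : IsOpen Λ) (hΛ : Λ ⊆ Metric.ball o Rmax)
    (hstar : ∀ y ∈ Metric.closedBall o Rmin, StarConvex ℝ y (Λ ∪ Metric.closedBall o Rmin))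
    (hu : ∀ z ∈ Λ, DifferentiableAt ℝ u z) (hc : ContinuousOn (grad u) Λ)
    (h0 : ∀ z ∈ Metric.closedBall o Rmin, Tendsto u (𝓝[Λ] z) (𝓝 0)) {y : E3}
    (hy : y ∈ Metric.closedBall o (Rmin / 2)) :
    ∫⁻ x in Λ, ENNReal.ofReal ((inner ℝ (x - y) (u x)) ^ 2) ≤
      ENNReal.ofReal ((2 * Rmax) ^ 4 * ((Rmin / (4 * Rmax)) ^ 3)⁻¹) *
        ∫⁻ x in Λ, ENNReal.ofReal (ddot (symGrad u x) (symGrad u x)) := by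
  have hmax : 0 < Rmax := hmin.trans hmm
  -- Since `‖x - y‖ ≤ 2 Rmax`, the point at parameter `s₀` is within `Rmin / 2` of `y`, which is
  -- itself within `Rmin / 2` of `o`; so it is still in the ball.
  set s₀ := Rmin / (4 * Rmax) with hs₀
  have hs₀p : 0 < s₀ := by positivity
  have hs₀1 : s₀ ≤ 1 := by rw [hs₀, div_le_one (by positivity)]; linarith
  have hyd : dist y o ≤ Rmin / 2 := hy
  have hyB : y ∈ Metric.closedBall o Rmin := hyd.trans (by linarith)
  set Φ : E3 → ENNReal :=
    Λ.indicator (fun z => ENNReal.ofReal (ddot (symGrad u z) (symGrad u z))) with hΦ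
  have hΦm : Measurable Φ := by
    classical
    have h1 : ContinuousOn (fun z => ENNReal.ofReal (ddot (symGrad u z) (symGrad u z))) Λ :=
      ENNReal.continuous_ofReal.comp_continuousOn
        (continuousOn_ddot_self (continuousOn_symGrad hc))
    have h2 := h1.measurable_piecewise (g := fun _ => 0) continuousOn_const hΛo.measurableSet
    rw [hΦ, ← Set.piecewise_eq_indicator]
    exact h2
  have hΦΛ : ∫⁻ x in Λ, ENNReal.ofReal (ddot (symGrad u x) (symGrad u x)) = ∫⁻ x, Φ x :=
    (lintegral_indicator hΛo.measurableSet _).symm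
  have hpt : ∀ x ∈ Λ, ENNReal.ofReal ((inner ℝ (x - y) (u x)) ^ 2) ≤
      ENNReal.ofReal ((2 * Rmax) ^ 4) * ∫⁻ s in Ioc s₀ 1, Φ (y + s • (x - y)) := fun x hx => by
    have hxd : dist x o < Rmax := hΛ hx
    have hxy : ‖x - y‖ ≤ 2 * Rmax := by
      rw [← dist_eq_norm]
      have := dist_triangle_right x y o
      linarith
    by_cases hxB : x ∈ Metric.closedBall o Rmin
    · have h1 : u x = 0 := by
        have h2 := h0 x hxB
        rw [hΛo.nhdsWithin_eq hx] at h2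
        exact tendsto_nhds_unique (hu x hx).continuousAt h2
      simp [h1]
    · refine (ofReal_inner_sq_le hu hc h0 hs₀p.le hs₀1 hx hxB (hstar y hyB) ?_).trans ?_
      · rw [Metric.mem_closedBall, dist_eq_norm, add_sub_right_comm]
        refine (norm_add_le _ _).trans ?_
        rw [norm_smul, Real.norm_of_nonneg hs₀p.le, ← dist_eq_norm]
        have h1 : s₀ * ‖x - y‖ ≤ s₀ * (2 * Rmax) := by gcongr
        have h2 : s₀ * (2 * Rmax) = Rmin / 2 := by rw [hs₀]; field_simp; norm_num
        linarith
      · gcongr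
  have hmeas : Measurable (fun q : E3 × ℝ => Φ (y + q.2 • (q.1 - y))) := by
    refine hΦm.comp ?_
    fun_prop
  calc ∫⁻ x in Λ, ENNReal.ofReal ((inner ℝ (x - y) (u x)) ^ 2)
      ≤ ∫⁻ x in Λ, ENNReal.ofReal ((2 * Rmax) ^ 4) * ∫⁻ s in Ioc s₀ 1, Φ (y + s • (x - y)) :=
        setLIntegral_mono' hΛo.measurableSet hpt
    _ ≤ ∫⁻ x, ENNReal.ofReal ((2 * Rmax) ^ 4) * ∫⁻ s in Ioc s₀ 1, Φ (y + s • (x - y)) :=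
        setLIntegral_le_lintegral _ _
    _ = ENNReal.ofReal ((2 * Rmax) ^ 4) * ∫⁻ x, ∫⁻ s in Ioc s₀ 1, Φ (y + s • (x - y)) :=
        lintegral_const_mul' _ _ ENNReal.ofReal_ne_top
    _ = ENNReal.ofReal ((2 * Rmax) ^ 4) * ∫⁻ s in Ioc s₀ 1, ∫⁻ x, Φ (y + s • (x - y)) := by
        rw [lintegral_lintegral_swap hmeas.aemeasurable]
    _ ≤ ENNReal.ofReal ((2 * Rmax) ^ 4) *
          ∫⁻ s in Ioc s₀ 1, ENNReal.ofReal (s₀ ^ 3)⁻¹ * ∫⁻ x, Φ x := by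
        gcongr 1
        refine setLIntegral_mono' measurableSet_Ioc fun s hs => ?_
        have hsp : 0 < s := hs₀p.trans hs.1
        rw [lintegral_comp_segment hΦm y hsp]
        have := hs.1.le
        gcongr
    _ ≤ ENNReal.ofReal ((2 * Rmax) ^ 4) * (ENNReal.ofReal (s₀ ^ 3)⁻¹ * ∫⁻ x, Φ x) := by
        gcongr 1
        rw [setLIntegral_const, Real.volume_Ioc]
        refine mul_le_of_le_one_right' ?_
        rw [ENNReal.ofReal_le_one]; linarith
    _ = _ := by rw [hΦΛ, ← mul_assoc, ← ENNReal.ofReal_mul (by positivity)]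

/-- Korn's inequality on a region that is star-shaped about a ball on which the field vanishes. -/
theorem lintegral_norm_sq_le_symGrad {Rmin Rmax : ℝ} (hmin : 0 < Rmin) (hmm : Rmin < Rmax)
    (hΛo : IsOpen Λ) (hΛ : Λ ⊆ Metric.ball o Rmax)
    (hstar : ∀ y ∈ Metric.closedBall o Rmin, StarConvex ℝ y (Λ ∪ Metric.closedBall o Rmin))
    (hu : ∀ z ∈ Λ, DifferentiableAt ℝ u z) (hc : ContinuousOn (grad u) Λ)
    (h0 : ∀ z ∈ Metric.closedBall o Rmin, Tendsto u (𝓝[Λ] z) (𝓝 0)) :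
    ENNReal.ofReal ((Rmin / 2) ^ 2) * ∫⁻ x in Λ, ENNReal.ofReal (‖u x‖ ^ 2) ≤
      ENNReal.ofReal (12 * ((2 * Rmax) ^ 4 * ((Rmin / (4 * Rmax)) ^ 3)⁻¹)) *
        ∫⁻ x in Λ, ENNReal.ofReal (ddot (symGrad u x) (symGrad u x)) := by
  have hmax : 0 < Rmax := hmin.trans hmm
  set r := Rmin / 2 with hr
  have hrp : 0 < r := by positivity
  set A := (2 * Rmax) ^ 4 * ((Rmin / (4 * Rmax)) ^ 3)⁻¹
  have hA : 0 ≤ A := by positivity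
  -- Subtracting the estimates for `o` and `Y i` isolates `r * u x i`. The final factor 12 is 3
  -- components, times 2 from squaring a difference, times 2 base points.
  set Y : Fin 3 → E3 := fun i => o + r • EuclideanSpace.single i 1 with hY
  have hYm : ∀ i, Y i ∈ Metric.closedBall o r := fun i => by
    rw [Metric.mem_closedBall, dist_eq_norm]
    simp [hY, norm_smul, abs_of_pos hrp]
  have hest := fun {y : E3} (hy : y ∈ Metric.closedBall o r) =>
    lintegral_inner_sq_le hmin hmm hΛo hΛ hstar hu hc h0 hy
  have huc : ContinuousOn u Λ := fun z hz => (hu z hz).continuousAt.continuousWithinAt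
  have hmeas : ∀ y, AEMeasurable (fun x => ENNReal.ofReal ((inner ℝ (x - y) (u x)) ^ 2))
      (volume.restrict Λ) := fun y =>
    (ENNReal.continuous_ofReal.comp_continuousOn
      (((continuousOn_id.sub continuousOn_const).inner (𝕜 := ℝ) huc).pow 2)).aemeasurable
      hΛo.measurableSet
  set I := ∫⁻ x in Λ, ENNReal.ofReal (ddot (symGrad u x) (symGrad u x))
  have hpt : ∀ x, ENNReal.ofReal (r ^ 2) * ENNReal.ofReal (‖u x‖ ^ 2) ≤
      ∑ i, 2 * (ENNReal.ofReal ((inner ℝ (x - o) (u x)) ^ 2) +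
        ENNReal.ofReal ((inner ℝ (x - Y i) (u x)) ^ 2)) := fun x => by
    have h2 : ∀ i, (2 : ENNReal) * (ENNReal.ofReal ((inner ℝ (x - o) (u x)) ^ 2) +
        ENNReal.ofReal ((inner ℝ (x - Y i) (u x)) ^ 2)) = ENNReal.ofReal
        (2 * ((inner ℝ (x - o) (u x)) ^ 2 + (inner ℝ (x - Y i) (u x)) ^ 2)) := fun i => by
      rw [ENNReal.ofReal_mul (by norm_num), ENNReal.ofReal_add (by positivity) (by positivity)]
      norm_num
    simp only [h2]
    rw [← ENNReal.ofReal_sum_of_nonneg fun i _ => by positivity,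
      ← ENNReal.ofReal_mul (by positivity)]
    refine ENNReal.ofReal_le_ofReal ?_
    have h3 : ‖u x‖ ^ 2 = ∑ i, u x i ^ 2 := by
      rw [← real_inner_self_eq_norm_sq, inner_eq_sum]; simp only [sq]
    rw [h3, Finset.mul_sum]
    refine Finset.sum_le_sum fun i _ => ?_
    have h4 : inner ℝ (x - Y i) (u x) = inner ℝ (x - o) (u x) - r * u x i := by
      rw [hY]
      simp only
      rw [← sub_sub, inner_sub_left (x - o), inner_smul_left, EuclideanSpace.inner_single_left]
      simp
    rw [h4]
    nlinarith [sq_nonneg (2 * inner ℝ (x - o) (u x) - r * u x i)]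
  calc ENNReal.ofReal (r ^ 2) * ∫⁻ x in Λ, ENNReal.ofReal (‖u x‖ ^ 2)
      = ∫⁻ x in Λ, ENNReal.ofReal (r ^ 2) * ENNReal.ofReal (‖u x‖ ^ 2) :=
        (lintegral_const_mul' _ _ ENNReal.ofReal_ne_top).symm
    _ ≤ ∫⁻ x in Λ, ∑ i, 2 * (ENNReal.ofReal ((inner ℝ (x - o) (u x)) ^ 2) +
        ENNReal.ofReal ((inner ℝ (x - Y i) (u x)) ^ 2)) := lintegral_mono hpt
    _ = ∑ i, 2 * ((∫⁻ x in Λ, ENNReal.ofReal ((inner ℝ (x - o) (u x)) ^ 2)) +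
        ∫⁻ x in Λ, ENNReal.ofReal ((inner ℝ (x - Y i) (u x)) ^ 2)) := by
        have hm : ∀ i, AEMeasurable (fun x => 2 * (ENNReal.ofReal ((inner ℝ (x - o) (u x)) ^ 2) +
            ENNReal.ofReal ((inner ℝ (x - Y i) (u x)) ^ 2))) (volume.restrict Λ) := fun i =>
          ((hmeas o).add (hmeas (Y i))).const_mul 2
        rw [lintegral_finsetSum' _ fun i _ => hm i]
        refine Finset.sum_congr rfl fun i _ => ?_
        rw [lintegral_const_mul' _ _ (by norm_num), lintegral_add_left' (hmeas o)]
    _ ≤ ∑ _i : Fin 3, 2 * (ENNReal.ofReal A * I + ENNReal.ofReal A * I) := by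
        gcongr with i
        · exact hest (Metric.mem_closedBall_self hrp.le)
        · exact hest (hYm i)
    _ = _ := by
        rw [ENNReal.ofReal_mul (p := 12) (q := A) (by norm_num), Finset.sum_const,
          Finset.card_univ, Fintype.card_fin, ENNReal.ofReal_ofNat, nsmul_eq_mul, ← two_mul]
        push_cast
        ring

end StarShaped

/-! ### Passage between referential and spatial fields. -/

lemma det_fderiv (f : E3 → E3) (x : E3) : (fderiv ℝ f x).det = (grad f x).det := by
  rw [ContinuousLinearMap.det,
    ← LinearMap.det_toMatrix (EuclideanSpace.basisFun (Fin 3) ℝ).toBasis]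
  congr 1

lemma act_one (u : E3) : act 1 u = u := by ext i; simp [act]

section Inverse

variable {f w : E3 → E3} {Ω : Set E3} {x : E3}

/-- By the inverse function theorem `f` maps `𝓝 x` onto `𝓝 (f x)`, and by injectivity on `Ω` the
global inverse undoes `f` near `x`. -/
lemma tendsto_invFunOn_nhds (ho : IsOpen Ω) (hinj : InjOn f Ω) (hx : x ∈ Ω)
    (hf : ContDiffAt ℝ 1 f x) (hdet : (grad f x).det ≠ 0) :
    Tendsto (Function.invFunOn f Ω) (𝓝 (f x)) (𝓝 x) ∧ f '' Ω ∈ 𝓝 (f x) := by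
  rw [← det_fderiv] at hdet
  have hs : HasStrictFDerivAt f
      ((fderiv ℝ f x).toContinuousLinearEquivOfDetNeZero hdet : E3 →L[ℝ] E3) x := by
    rw [ContinuousLinearMap.coe_toContinuousLinearEquivOfDetNeZero]
    exact hf.hasStrictFDerivAt (by norm_num)
  rw [← hs.map_nhds_eq_of_equiv]
  refine ⟨?_, image_mem_map (ho.mem_nhds hx)⟩
  rw [tendsto_map'_iff]
  refine tendsto_id.congr' ?_
  filter_upwards [ho.mem_nhds hx] with y hy
  exact (hinj.leftInvOn_invFunOn hy).symm

/-- The spatial gradient of a field that is given in terms of a reference. -/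
lemma grad_comp_invFunOn (ho : IsOpen Ω) (hinj : InjOn f Ω) (hx : x ∈ Ω)
    (hf : ContDiffAt ℝ 1 f x) (hdet : (grad f x).det ≠ 0) (hw : DifferentiableAt ℝ w x) :
    DifferentiableAt ℝ (w ∘ Function.invFunOn f Ω) (f x) ∧
      grad (w ∘ Function.invFunOn f Ω) (f x) = grad w x * (grad f x)⁻¹ := by
  obtain ⟨hg, hmem⟩ := tendsto_invFunOn_nhds ho hinj hx hf hdet
  have hunit : IsUnit (grad f x).det := hdet.isUnit
  have hgx : Function.invFunOn f Ω (f x) = x := hinj.leftInvOn_invFunOn hx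
  rw [← det_fderiv] at hdet
  set e := (fderiv ℝ f x).toContinuousLinearEquivOfDetNeZero hdet with he
  have hec : (e : E3 →L[ℝ] E3) = fderiv ℝ f x :=
    ContinuousLinearMap.coe_toContinuousLinearEquivOfDetNeZero _ _
  have hfd : HasFDerivAt f (e : E3 →L[ℝ] E3) (Function.invFunOn f Ω (f x)) := by
    rw [hgx, hec]; exact (hf.differentiableAt (by norm_num)).hasFDerivAt
  have hgd : HasFDerivAt (Function.invFunOn f Ω) (e.symm : E3 →L[ℝ] E3) (f x) := by
    refine HasFDerivAt.of_local_left_inverse ?_ hfd ?_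
    · rw [ContinuousAt, hgx]; exact hg
    · filter_upwards [hmem] with y hy using Function.invFunOn_eq hy
  have hwd : HasFDerivAt w (fderiv ℝ w x) (Function.invFunOn f Ω (f x)) := by
    rw [hgx]; exact hw.hasFDerivAt
  have hud := hwd.comp (f x) hgd
  refine ⟨hud.differentiableAt, ?_⟩
  have hsymm : ∀ h, e.symm h = act (grad f x)⁻¹ h := fun h => by
    rw [ContinuousLinearEquiv.symm_apply_eq]
    have h1 : e (act (grad f x)⁻¹ h) = fderiv ℝ f x (act (grad f x)⁻¹ h) := by rw [← hec]; rfl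
    rw [h1, ← act_grad, ← Reference.act_mul, Matrix.mul_nonsing_inv _ hunit, act_one]
  ext i j
  rw [grad_apply, hud.fderiv]
  have h2 : ((fderiv ℝ w x).comp (e.symm : E3 →L[ℝ] E3)) (EuclideanSpace.single j 1) =
      act (grad w x * (grad f x)⁻¹) (EuclideanSpace.single j 1) := by
    rw [Reference.act_mul, act_grad, ← hsymm]; rfl
  rw [h2]
  simp [act_apply]

end Inverse

/-- Here `z` may be a boundary point of the image, where the inverse need not have a limit. By
compactness every ultrafilter of preimages converges to some `x` with `f x = z`, and `w` vanishes at
all such `x`. -/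
lemma tendsto_comp_invFunOn_zero {f w : E3 → E3} {Ω : Set E3} {z : E3}
    (hK : IsCompact (closure Ω)) (hf : ∀ x ∈ closure Ω, ContinuousAt f x)
    (hw : ∀ x ∈ closure Ω, ContinuousAt w x) (h0 : ∀ x ∈ closure Ω, f x = z → w x = 0) :
    Tendsto (w ∘ Function.invFunOn f Ω) (𝓝[f '' Ω] z) (𝓝 0) := by
  rw [tendsto_iff_ultrafilter]
  intro U hU
  have hΛ : f '' Ω ∈ (U : Filter E3) := hU self_mem_nhdsWithin
  have hUK : ((U.map (Function.invFunOn f Ω) : Ultrafilter E3) : Filter E3) ≤ 𝓟 (closure Ω) := by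
    rw [le_principal_iff, Ultrafilter.coe_map, mem_map]
    exact mem_of_superset hΛ fun y hy => subset_closure (Function.invFunOn_mem hy)
  obtain ⟨x, hx, hUx⟩ := hK.ultrafilter_le_nhds _ hUK
  rw [Ultrafilter.coe_map] at hUx
  have hfx : f x = z := by
    refine tendsto_nhds_unique (f := f ∘ Function.invFunOn f Ω) (l := (U : Filter E3))
      ((hf x hx).tendsto.comp hUx) ?_
    refine (tendsto_id'.2 (hU.trans nhdsWithin_le_nhds)).congr' ?_
    filter_upwards [hΛ] with y hy using (Function.invFunOn_eq hy).symm
  have := (hw x hx).tendsto.comp hUx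
  rwa [h0 x hx hfx] at this

/-- The Poincaré–Korn constant of regions within distance `Rmax` of the centre of a ball of radius
`Rmin` about which they are star-shaped. -/
noncomputable def kornConstant (Rmin Rmax : ℝ) : ℝ :=
  -- The quotient of the two constants in `lintegral_norm_sq_le_symGrad`, doubled because the
  -- definition uses `C / 2`.
  2 * ((Rmin / 2) ^ 2 / (12 * ((2 * Rmax) ^ 4 * ((Rmin / (4 * Rmax)) ^ 3)⁻¹)))

namespace Reference

theorem StarShapedAboutRest.isPoincareKornConstant {S : Reference} {Rmin Rmax : ℝ} {o : ℝ → E3}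
    (hmin : 0 < Rmin) (hmm : Rmin < Rmax) (h : S.StarShapedAboutRest Rmin Rmax o) :
    S.IsPoincareKornConstant (kornConstant Rmin Rmax) := by
  have hmax : 0 < Rmax := hmin.trans hmm
  refine ⟨by unfold kornConstant; positivity, fun t ht w hw => ?_⟩
  obtain ⟨hball, hstar, hrest⟩ := h t ht
  set f := S.lam t with hf
  set Ω := S.Ω with hΩ
  set g := Function.invFunOn f Ω with hg
  set u := w ∘ g with hu
  have hinj : InjOn f Ω := S.injOn t ht
  have hfc : ∀ x ∈ closure Ω, ContDiffAt ℝ 1 f x := fun x hx =>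
    (contDiffAt_lam ht hx).of_le (by norm_num)
  have hdet : ∀ x ∈ closure Ω, (grad f x).det ≠ 0 := fun x hx => (S.det_pos t ht x hx).ne'
  have hwd : ∀ x ∈ closure Ω, DifferentiableAt ℝ w x := fun x hx =>
    (hw.smooth x hx).differentiableAt (by norm_num)
  have hgf : ∀ x ∈ Ω, g (f x) = x := fun x hx => hinj.leftInvOn_invFunOn hx
  have hΛo : IsOpen (f '' Ω) := isOpen_iff_mem_nhds.2 fun _ ⟨x, hx, hxy⟩ => hxy ▸
    (tendsto_invFunOn_nhds S.isOpen hinj hx (hfc x (subset_closure hx))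
      (hdet x (subset_closure hx))).2
  have hgrad := fun x (hx : x ∈ Ω) => grad_comp_invFunOn S.isOpen hinj hx
    (hfc x (subset_closure hx)) (hdet x (subset_closure hx)) (hwd x (subset_closure hx))
  have hgradc : ∀ v : E3 → E3, (∀ x ∈ closure Ω, ContDiffAt ℝ 1 v x) →
      ContinuousOn (grad v) (closure Ω) := fun v hv => by
    refine continuousOn_pi.2 fun i => continuousOn_pi.2 fun j => fun x hx => ?_
    exact ((coordL i).continuous.continuousAt.comp
      (((hv x hx).continuousAt_fderiv (by norm_num)).clm_apply
        continuousAt_const)).continuousWithinAt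
  have hsg : ContinuousOn (S.sgrad t w) (closure Ω) := by
    refine (hgradc w hw.smooth).mul fun x hx => ?_
    have h1 : ContinuousAt (Inv.inv : Matrix (Fin 3) (Fin 3) ℝ → _) (grad f x) := by
      refine continuousAt_matrix_inv _ ?_
      rw [Ring.inverse_eq_inv']
      exact continuousAt_inv₀ (hdet x hx)
    exact h1.comp_continuousWithinAt (hgradc f hfc x hx)
  have hD : ContinuousOn (S.D t w) (closure Ω) :=
    ContinuousOn.const_smul
      (hsg.add ((continuous_id.matrix_transpose).comp_continuousOn hsg)) (1 / 2 : ℝ)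
  have hgcont : ContinuousOn g (f '' Ω) := by
    rintro _ ⟨x, hx, rfl⟩
    refine ContinuousAt.continuousWithinAt ?_
    rw [ContinuousAt, hgf x hx]
    exact (tendsto_invFunOn_nhds S.isOpen hinj hx (hfc x (subset_closure hx))
      (hdet x (subset_closure hx))).1
  have hguc : ContinuousOn (grad u) (f '' Ω) := by
    have h1 : ContinuousOn (fun y => S.sgrad t w (g y)) (f '' Ω) :=
      hsg.comp hgcont fun y hy => subset_closure (Function.invFunOn_mem hy)
    refine h1.congr ?_
    rintro _ ⟨x, hx, rfl⟩
    simp only [hgf x hx]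
    exact (hgrad x hx).2
  have hkorn := lintegral_norm_sq_le_symGrad (u := u) hmin hmm hΛo hball hstar
    (by rintro _ ⟨x, hx, rfl⟩; exact (hgrad x hx).1) hguc
    fun z hz => tendsto_comp_invFunOn_zero S.isCompact_closure
      (fun x hx => (hfc x hx).continuousAt) (fun x hx => (hw.smooth x hx).continuousAt)
      fun x hx hxz => hw.at_rest x (hrest x hx (by rw [hxz]; exact hz))
  -- The change of variables also turns the extended integrals of the spatial inequality into the
  -- real integrals of the claim, which are finite by continuity up to the boundary.
  have hcov : ∀ (Ψ : E3 → ℝ) (ψ : E3 → ℝ), (∀ x ∈ Ω, Ψ (f x) = ψ x) → (∀ x, 0 ≤ ψ x) →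
      ContinuousOn ψ (closure Ω) →
      ∫⁻ y in f '' Ω, ENNReal.ofReal (Ψ y) = ENNReal.ofReal (∫ x in Ω, ψ x * S.J t x) := by
    intro Ψ ψ hΨ hψ hψc
    have hi : IntegrableOn (fun x => ψ x * S.J t x) Ω :=
      integrableOn_of_continuousOn (hψc.mul (continuousOn_J ht))
    rw [lintegral_image_eq_lintegral_abs_det_fderiv_mul volume S.isOpen.measurableSet
      (fun x hx => ((hfc x (subset_closure hx)).differentiableAt
        (by norm_num)).hasFDerivAt.hasFDerivWithinAt) hinj,
      ofReal_integral_eq_lintegral_ofReal hi]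
    · refine setLIntegral_congr_fun S.isOpen.measurableSet fun x hx => ?_
      have hJ := J_pos ht (subset_closure hx)
      simp only [det_fderiv]
      rw [hΨ x hx, mul_comm (ψ x), ENNReal.ofReal_mul hJ.le]
      congr 2
      exact abs_of_pos hJ
    · filter_upwards [ae_restrict_mem S.isOpen.measurableSet] with x hx
      exact mul_nonneg (hψ x) (J_pos ht (subset_closure hx)).le
  rw [hcov (fun y => ‖u y‖ ^ 2) (fun x => ‖w x‖ ^ 2) (fun x hx => by
      simp only [hu, Function.comp_apply, hgf x hx]) (fun x => by positivity)
      (ContinuousOn.pow (ContinuousOn.norm fun x hx =>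
        (hw.smooth x hx).continuousAt.continuousWithinAt) 2),
    hcov _ (fun x => ddot (S.D t w x) (S.D t w x)) (fun x hx => by
      have h1 : symGrad u (f x) = S.D t w x := by rw [symGrad, (hgrad x hx).2]; rfl
      rw [h1]) (fun x => ddot_self_nonneg _) (continuousOn_ddot_self hD),
    ← ENNReal.ofReal_mul (by positivity), ← ENNReal.ofReal_mul (by positivity),
    ENNReal.ofReal_le_ofReal_iff (mul_nonneg (by positivity)
      (setIntegral_nonneg S.isOpen.measurableSet fun x hx =>
        mul_nonneg (ddot_self_nonneg _) (J_pos ht (subset_closure hx)).le))] at hkorn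
  unfold kornConstant
  rw [mul_div_cancel_left₀ _ (two_ne_zero), div_mul_eq_mul_div, div_le_iff₀ (by positivity),
    mul_comm (∫ x in Ω, ddot (S.D t w x) (S.D t w x) * S.J t x)]
  exact hkorn

end Reference

end ALE

theorem theorem61 :
    (∀ (S : ALE.Reference) (ρ μ C M : ℝ) (v : ℝ → ALE.E3 → ALE.E3) (p : ℝ → ALE.E3 → ℝ)
        (b : ℝ → ALE.E3 → ALE.E3),
      0 < ρ → 0 < μ → S.IsPoincareKornConstant C →
      S.IsFlow ρ μ v p b → S.LagrangianAtFree v → S.LoadBound ρ μ C M v p b →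
      (∀ t, S.t₀ ≤ t →
        S.K ρ v t ≤ Real.exp (-(μ / ρ * C * (t - S.t₀))) * S.K ρ v S.t₀ +
          (1 - Real.exp (-(μ / ρ * C * (t - S.t₀)))) *
            (M ^ 2 / (2 * (μ / ρ) ^ 2 * C ^ 2))) ∧
      limsup (S.K ρ v) atTop ≤ M ^ 2 / (2 * (μ / ρ) ^ 2 * C ^ 2)) ∧
    (∀ Rmin Rmax : ℝ, 0 < Rmin → Rmin < Rmax → ∃ C : ℝ, ∀ (S : ALE.Reference) (o : ℝ → ALE.E3),
      S.StarShapedAboutRest Rmin Rmax o → S.IsPoincareKornConstant C) := by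
  refine ⟨fun S ρ μ C M v p b hρ hμ hC hflow hL hM => ?_, fun Rmin Rmax hmin hmm =>
    ⟨ALE.kornConstant Rmin Rmax, fun S o h => h.isPoincareKornConstant hmin hmm⟩⟩
  have hK : ∀ t, S.t₀ ≤ t → _ := fun t ht => hflow.K_le hρ hμ hC hL hM ht
  exact ⟨hK, ALE.limsup_le_of_exp_decay (mul_pos (div_pos hμ hρ) hC.1)
    (fun t ht => ALE.Reference.K_nonneg hρ v ht) hK⟩
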